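/- **Setting.** A hybrid dynamical system is a tuple $H=(D,F,G,R)$, where $D=\coprod_{j\in J}D_j$ is a finite disjoint union of connected smooth manifolds with boundary (Hausdorff, second countable, with dimensions $\dim D_j\ge 1$ that may depend on $j$), $F$ is a smooth vector field on $D$, the guard $G\subset\partial D$ is a relatively open subset of the boundary on which $F$ is outward-pointing, and the reset map $R:G\to D$ is smooth. An execution is a right-continuous function $x:T\to D$ on an interval $T\subset\mathbb R$ such that $\dot x(t)=F(x(t))$ wherever $x$ is continuous, while at each discontinuity $t$ the limit $x(t^-)$ exists, lies in $G$, and $R(x(t^-))=x(t)$. Let $\gamma:\mathbb R\to D$ be a $\tau$-periodic orbit, i.e. a $\tau$-periodic execution, where $\tau>0$ is the smallest positive number with $\gamma(s+\tau)=\gamma(s)$ for some $s$, and assume that $\gamma$ has only finitely many discontinuities in every bounded time interval. The point set of $\gamma$ consists of the values $\gamma(t)$ and of the exit points $\gamma(t^-)$. A Poincaré section is a smooth embedded submanifold $\Sigma$ (without boundary, of codimension one) of one of the domains $D_{j_0}$, which meets the point set of $\gamma$ in exactly one point $\xi$ and with $F(\xi)\notin T_\xi\Sigma$. A Poincaré map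 for $\gamma$ is a smooth map $P:U\to\Sigma$ on an open set $U\subset\Sigma$ containing $\xi$ such that for each $x\in U$ an execution with finitely many transitions, started at $x$, first returns to $\Sigma$ in positive time at the point $P(x)$ (exit points count as points of the execution; from $x\in G$ one starts by applying $R$), and the number of transitions and the ordered list of domains traversed are the same for all $x\in U$. Let $m=\min_{j\in J}\dim D_j$, and assume that $\gamma$ visits at least one domain of dimension $m$ (which is automatic if $\gamma$ visits every domain). **Corollary.** Let $P:U\to\Sigma$ be a Poincaré map for $\gamma$ with $\{\xi\}=\gamma\cap\Sigma$. If $$\operatorname{rank} DP^m(\xi)=\min_{j\in J}\dim D_j-1=m-1,$$ then there is an open set $V\subset U$ containing $\xi$ such that, for all $x\in V$, the iterate $P^m$ is defined at $x$ and $\operatorname{rank}DP^m(x)=m-1$. Thus the hypotheses of the Exact Reduction theorem are satisfied with $r=m-1$; that is, $\gamma$ is a periodic orbit with isolated transitions, $P$ is a Poincaré map for $\gamma$, $m=\min_j\dim D_j$, and there is a connected open set $V\subset U$ containing $\xi$ such that $P^m$ is defined on $V$ and $\operatorname{rank}DP^m(x)=r$ for all $x\in V$. -/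

import Mathlib

open Set Filter Topology Function
open scoped Manifold ContDiff

noncomputable section HybridDefinitions

universe u v w

variable {J : Type v} (dim : J → ℕ) [∀ j, NeZero (dim j)] (D : J → Type u)
  [∀ j, TopologicalSpace (D j)] [∀ j, ChartedSpace (EuclideanHalfSpace (dim j)) (D j)]
  [∀ j, IsManifold (𝓡∂ (dim j)) ∞ (D j)]

/-- A (smooth) hybrid dynamical system `(D, F, G, R)` over the disjoint union `Σ j, D j` of smooth
manifolds with boundary, where `D j` has dimension `dim j`. Only the values of `R` on the guard
`G` are meaningful. -/
structure HybridSystem where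
  /-- the vector field -/
  F : ∀ j, (x : D j) → TangentSpace (𝓡∂ (dim j)) x
  F_smooth : ∀ j, ContMDiff (𝓡∂ (dim j)) (𝓡∂ (dim j)).tangent ∞
    (fun x : D j => (⟨x, F j x⟩ : TangentBundle (𝓡∂ (dim j)) (D j)))
  /-- the guard -/
  G : ∀ j, Set (D j)
  /-- `G` is a relatively open subset of the boundary -/
  G_open : ∀ j, ∃ O : Set (D j), IsOpen O ∧ G j = O ∩ (𝓡∂ (dim j)).boundary (D j)
  /-- the reset map -/
  R : ∀ j, D j → Σ k, D k
  /-- `R` is smooth on `G`: near each point of the guard it takes its values in one single domain,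
  and it is smooth there along the guard -/
  R_smooth : ∀ j, ∀ g ∈ G j, ∃ k, ∃ f : D j → D k,
    (∀ᶠ y in 𝓝[G j] g, R j y = ⟨k, f y⟩) ∧
      ContMDiffWithinAt (𝓡∂ (dim j)) (𝓡∂ (dim k)) ∞ f (G j) g

namespace HybridSystem

variable {dim D} (H : HybridSystem dim D)

/-- `F` is outward-pointing on the guard: in every smooth chart around a point of `G`, the
coordinate that vanishes on the boundary (the half-space is `{y | 0 ≤ y 0}`) has negative
derivative along `F`. -/
def OutwardPointing : Prop :=
  ∀ j, ∀ x ∈ H.G j, ∀ e ∈ IsManifold.maximalAtlas (𝓡∂ (dim j)) ∞ (D j), x ∈ e.source →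
    (show EuclideanSpace ℝ (Fin (dim j)) from
      mfderiv (𝓡∂ (dim j)) 𝓘(ℝ, EuclideanSpace ℝ (Fin (dim j))) (e.extend (𝓡∂ (dim j))) x
        (H.F j x)) 0 < 0

/-- `χ` is differentiable at `t` relative to `T`, with derivative `F (χ t)`. -/
def HasVelocityAt (χ : ℝ → Σ j, D j) (T : Set ℝ) (t : ℝ) : Prop :=
  ∃ j, ∃ c : ℝ → D j, (∀ᶠ s in 𝓝[T] t, χ s = ⟨j, c s⟩) ∧
    HasMFDerivWithinAt 𝓘(ℝ, ℝ) (𝓡∂ (dim j)) c T t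
      ((1 : ℝ →L[ℝ] ℝ).smulRight (H.F j (c t)))

/-- `χ` (restricted to the interval `T`) is an execution. -/
structure IsExecution (χ : ℝ → Σ j, D j) (T : Set ℝ) : Prop where
  interval : T.OrdConnected
  right_continuous : ∀ t ∈ T, ContinuousWithinAt χ (T ∩ Ici t) t
  flow : ∀ t ∈ T, ContinuousWithinAt χ T t → H.HasVelocityAt χ T t
  jump : ∀ t ∈ T, ¬ ContinuousWithinAt χ T t →
    ∃ j, ∃ g ∈ H.G j, Tendsto χ (𝓝[T ∩ Iio t] t) (𝓝 ⟨j, g⟩) ∧ H.R j g = χ t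

/-- `γ` is a `τ`-periodic orbit: a periodic execution, defined on all of `ℝ`, and `τ > 0` is the
smallest positive number with `γ (s + τ) = γ s` for some `s`. -/
structure IsPeriodicOrbit (γ : ℝ → Σ j, D j) (τ : ℝ) : Prop where
  execution : H.IsExecution γ univ
  period_pos : 0 < τ
  periodic : Periodic γ τ
  minimal : ∀ σ, 0 < σ → ∀ s, γ (s + σ) = γ s → τ ≤ σ

/-- Only finitely many discrete transitions occur in each bounded interval of time. -/
def IsolatedTransitions (γ : ℝ → Σ j, D j) : Prop :=
  ∀ a b : ℝ, ({t | ¬ ContinuousAt γ t} ∩ Icc a b).Finite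

/-- The point set of an orbit: its image, together with the exit points, i.e. the left limits at
the instants of transition. -/
def orbitSet (γ : ℝ → Σ j, D j) : Set (Σ j, D j) :=
  {p | ∃ t, γ t = p ∨ Tendsto γ (𝓝[<] t) (𝓝 p)}

/-- An execution over the compact interval `[0, t (N + 1)]` with exactly `N` transitions, recorded
piece by piece. Transitions occur at `t 1 < ⋯ < t N`; during `[t i, t (i + 1)]` the state is
`c i` in the domain `D (j i)`, each piece being closed up by its left limit, the exit point
`c i (t (i + 1)) ∈ G`, from which the reset map leads to the initial point of the next piece.
Pieces of zero length can occur only at the two ends: `t 1 = 0` when the initial state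
lies in the guard, and `t N = t (N + 1)` when the final state is the result of a reset.
Values of `t`, `c`, `j` at larger indices are irrelevant. -/
structure IsArc (N : ℕ) (j : ℕ → J) (t : ℕ → ℝ) (c : ∀ i, ℝ → D (j i)) : Prop where
  t_zero : t 0 = 0
  t_pos : 0 < t (N + 1)
  t_le : ∀ i ≤ N, t i ≤ t (i + 1)
  t_lt : ∀ i, 0 < i → i < N → t i < t (i + 1)
  flow : ∀ i ≤ N, IsMIntegralCurveOn (I := 𝓡∂ (dim (j i))) (c i) (H.F (j i))
    (Icc (t i) (t (i + 1)))
  exit_mem : ∀ i < N, c i (t (i + 1)) ∈ H.G (j i)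
  reset : ∀ i < N, H.R (j i) (c i (t (i + 1))) = ⟨j (i + 1), c (i + 1) (t (i + 1))⟩

section Poincare

variable {d : ℕ} {S : Type w} [TopologicalSpace S] [ChartedSpace (EuclideanSpace ℝ (Fin d)) S]

/-- The map `ι : S → D j₀` exhibits `S` as a smooth embedded submanifold of codimension one of
`D j₀`. -/
structure IsEmbeddedHypersurface {j₀ : J} (ι : S → D j₀) : Prop where
  codim_one : d + 1 = dim j₀
  smooth : ContMDiff (𝓡 d) (𝓡∂ (dim j₀)) ∞ ι
  immersion : ∀ x, Injective (mfderiv (𝓡 d) (𝓡∂ (dim j₀)) ι x)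
  embedding : IsEmbedding ι

/-- `ι : S → D j₀` is a Poincaré section for `γ` at `ξ`: an embedded hypersurface that meets the
orbit in the single point `ξ`, where it is transverse to the vector field. -/
structure IsPoincareSection (γ : ℝ → Σ j, D j) {j₀ : J} (ι : S → D j₀) (ξ : S) : Prop where
  hypersurface : IsEmbeddedHypersurface (dim := dim) (d := d) ι
  meets : ∀ x, (⟨j₀, ι x⟩ : Σ j, D j) ∈ orbitSet γ ↔ x = ξ
  transverse : H.F j₀ (ι ξ) ∉ Set.range (mfderiv (𝓡 d) (𝓡∂ (dim j₀)) ι ξ)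

/-- `y` is the point of first return to the section `ι : S → D j₀` of an execution that starts
at `x` and runs, with `N` transitions, through the domains `D (j 0), …, D (j N)` in this order. -/
def FirstReturn {j₀ : J} (ι : S → D j₀) (N : ℕ) (j : ℕ → J) (x y : S) : Prop :=
  ∃ (t : ℕ → ℝ) (c : ∀ i, ℝ → D (j i)), H.IsArc N j t c ∧
    (⟨j 0, c 0 0⟩ : Σ k, D k) = ⟨j₀, ι x⟩ ∧
    (⟨j N, c N (t (N + 1))⟩ : Σ k, D k) = ⟨j₀, ι y⟩ ∧
    ∀ i ≤ N, ∀ s ∈ Icc (t i) (t (i + 1)), ∀ z : S, (⟨j i, c i s⟩ : Σ k, D k) = ⟨j₀, ι z⟩ →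
      (i = 0 ∧ s = 0) ∨ (i = N ∧ s = t (N + 1))

/-- `P : U → S` is a Poincaré map for `γ` over the section `ι : S → D j₀` at `ξ`: it is smooth on
the open set `U ∋ ξ`, and it is obtained by tracing executions from `x ∈ U` forward, through one
and the same cycle of domains, until they first return to the section, at `P x`.
Values of `P` outside `U` are irrelevant. -/
structure IsPoincareMap (γ : ℝ → Σ j, D j) {j₀ : J} (ι : S → D j₀) (ξ : S)
    (U : Set S) (P : S → S) : Prop where
  sect : H.IsPoincareSection (d := d) γ ι ξ
  isOpen : IsOpen U
  mem : ξ ∈ U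
  smooth : ContMDiffOn (𝓡 d) (𝓡 d) ∞ P U
  traces : ∃ (N : ℕ) (j : ℕ → J), ∀ x ∈ U, H.FirstReturn ι N j x (P x)

/-- `rank DQ(x)` for a self-map `Q` of the section. -/
def rankAt (d : ℕ) {S : Type w} [TopologicalSpace S] [ChartedSpace (EuclideanSpace ℝ (Fin d)) S]
    (Q : S → S) (x : S) : ℕ :=
  Module.finrank ℝ (LinearMap.range (mfderiv (𝓡 d) (𝓡 d) Q x).toLinearMap)

/-- The `k`-th iterate of the partial map `P : U → S` is defined at `x`. -/
def IterateDefinedAt (U : Set S) (P : S → S) (k : ℕ) (x : S) : Prop :=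
  ∀ i < k, P^[i] x ∈ U

/-- The hypotheses of the Exact Reduction theorem with rank `r`: `γ` is a periodic orbit with
isolated transitions, `P : U → S` is a Poincaré map for `γ`, `m` is the minimal dimension of the
domains, and `DP^m` has constant rank `r` on a neighborhood (a connected open set `V ⊆ U`)
of `ξ`. -/
structure ExactReductionHypotheses (γ : ℝ → Σ j, D j) (τ : ℝ) {j₀ : J} (ι : S → D j₀) (ξ : S)
    (U : Set S) (P : S → S) (m r : ℕ) : Prop where
  orbit : H.IsPeriodicOrbit γ τ
  isolated : IsolatedTransitions γ
  poincare : H.IsPoincareMap (d := d) γ ι ξ U P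
  min_dim : m = ⨅ j, dim j
  constant_rank : ∃ V : Set S, IsOpen V ∧ IsConnected V ∧ ξ ∈ V ∧ V ⊆ U ∧
    ∀ x ∈ V, IterateDefinedAt U P m x ∧ rankAt d P^[m] x = r

end Poincare

end HybridSystem

end HybridDefinitions

/-! The rank of `DP^m` is squeezed between two bounds near `ξ`. From below, rank is lower
semicontinuous, so it is at least `m - 1` near `ξ`. From above, the chain rule gives `rank DP^m ≤
rank DP`, and `rank DP ≤ m - 1` near `ξ` because every trajectory traced by `P` passes through a
domain of dimension `m`. Either it leaves that domain through the guard, which lies in a boundary of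
dimension `m - 1`, or that domain is the last one, which contains the section, and then the section
itself has dimension `m - 1`.

In the first case the bottleneck is not expressed by factoring `P` through smooth maps, which would
require smooth flow and hitting maps up to the boundary. It is expressed by Hausdorff dimension:
exit points form a set of dimension at most `m - 1`; resets, flows for a fixed time and hits of a
transverse set are Lipschitz relations in charts, up to countable unions, so they do not raise
dimension (`MDimLE_reset`, `MDimLE.flow_time`, `exists_nhds_MDimLE_hit`). Hence `P` maps a
neighbourhood of `ξ` to a set of dimension at most `m - 1`, which bounds the rank by
`HasStrictFDerivAt.finrank_range_le_dimH_image`.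

That the trajectories visit an `m`-dimensional domain follows from forward uniqueness
(`IsForwardCurve.eventuallyEq`): `γ` follows the arc that starts at `ξ`, so the arc ends at a point
common to the orbit and the section, that is, at `ξ`. Thus `P ξ = ξ`, and minimality of `τ` makes
the arc cover a full period (`IsPeriodicOrbit.arc_visits`). -/

section NormedSpaces

/-! ### Hausdorff dimension, rank and transverse hitting in normed spaces -/

/-- A relation that satisfies a Lipschitz estimate does not increase the Hausdorff dimension. -/
theorem dimH_relation_image_le {X Y : Type*} [MetricSpace X] [MetricSpace Y] {r : X → Y → Prop}
    {L : ℝ} (hr : ∀ u v u' v', r u v → r u' v' → dist v v' ≤ L * dist u u') (A : Set X) :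
    dimH {v | ∃ u ∈ A, r u v} ≤ dimH A := by
  classical
  rcases isEmpty_or_nonempty Y with hY | hY
  · rw [show {v | ∃ u ∈ A, r u v} = ∅ from Subsingleton.elim _ _]; simp
  -- The estimate with `u = u'` forces `v = v'`, so `r` is the graph of a partial function; its
  -- values elsewhere are arbitrary.
  let h : X → Y := fun u => if hu : ∃ v, r u v then hu.choose else hY.some
  have hh : ∀ u v, r u v → h u = v := fun u v huv => by
    have hu : ∃ v, r u v := ⟨v, huv⟩
    have h1 : r u (h u) := by simp only [h, dif_pos hu]; exact hu.choose_spec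
    have := hr _ _ _ _ h1 huv
    rw [dist_self, mul_zero] at this
    exact dist_le_zero.1 this
  have hset : {v | ∃ u ∈ A, r u v} = h '' {u ∈ A | ∃ v, r u v} := by
    ext v
    constructor
    · rintro ⟨u, hu, huv⟩
      exact ⟨u, ⟨hu, v, huv⟩, hh u v huv⟩
    · rintro ⟨u, ⟨hu, v', huv⟩, rfl⟩
      exact ⟨u, hu, by rwa [hh u v' huv]⟩
  rw [hset]
  have hL : LipschitzOnWith (Real.toNNReal L) h {u ∈ A | ∃ v, r u v} := by
    refine LipschitzOnWith.of_dist_le_mul ?_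
    rintro u ⟨-, v, huv⟩ u' ⟨-, v', huv'⟩
    rw [hh u v huv, hh u' v' huv']
    exact (hr _ _ _ _ huv huv').trans
      (mul_le_mul_of_nonneg_right (Real.le_coe_toNNReal L) dist_nonneg)
  exact hL.dimH_image_le.trans (dimH_mono fun u hu => hu.1)

variable {E F : Type*} [NormedAddCommGroup E] [NormedSpace ℝ E]
  [NormedAddCommGroup F] [NormedSpace ℝ F]

/-- The rank of the derivative is a lower bound for the dimension of the image. -/
theorem HasStrictFDerivAt.finrank_range_le_dimH_image [CompleteSpace E] [FiniteDimensional ℝ F]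
    {f : E → F} {f' : E →L[ℝ] F} {x : E} (hf : HasStrictFDerivAt f f' x) {W : Set E}
    (hW : W ∈ 𝓝 x) :
    (Module.finrank ℝ (LinearMap.range f'.toLinearMap) : ENNReal) ≤ dimH (f '' W) := by
  -- Projecting onto the range of `f'` makes `f` a submersion at `x`, so the projected image
  -- contains an open set of full dimension; the projection is Lipschitz and cannot raise dimension.
  obtain ⟨π, hπ⟩ := (LinearMap.range f'.toLinearMap).exists_isCompl
  let p : F →L[ℝ] LinearMap.range f'.toLinearMap :=
    LinearMap.toContinuousLinearMap (Submodule.projectionOnto _ π hπ)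
  have hp : HasStrictFDerivAt (p ∘ f) (p.comp f') x := p.hasStrictFDerivAt.comp x hf
  have hsurj : LinearMap.range (p.comp f').toLinearMap = ⊤ := by
    rw [LinearMap.range_eq_top]
    rintro ⟨_, y, rfl⟩
    refine ⟨y, ?_⟩
    exact Submodule.projectionOnto_apply_left hπ ⟨f' y, y, rfl⟩
  have hmap := hp.map_nhds_eq_of_surj hsurj
  have hmem : (p ∘ f) '' W ∈ 𝓝 ((p ∘ f) x) := by
    rw [← hmap]; exact image_mem_map hW
  rw [← Real.dimH_of_mem_nhds hmem, image_comp]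
  exact p.lipschitz.dimH_image_le _

/-- Two integral curves of a Lipschitz vector field, both run until they hit a set transverse to
the field: the distance of the points that are hit is controlled by that of the initial points. -/
theorem dist_transverse_hit_le {v : E → E} {B : Set E} {K : NNReal} {κ : ℝ} {v₀ : E}
    (hv : LipschitzOnWith K v B) (hκ : 0 < κ) (hnear : ∀ y ∈ B, ‖v y - v₀‖ ≤ κ / 2)
    {f g : ℝ → E} {b b' : ℝ} (hb : 0 ≤ b) (hb1 : b ≤ 1) (hb' : 0 ≤ b') (hb1' : b' ≤ 1)
    (hf : ∀ t ∈ Icc 0 b, HasDerivWithinAt f (v (f t)) (Icc 0 b) t) (hfB : ∀ t ∈ Icc 0 b, f t ∈ B)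
    (hg : ∀ t ∈ Icc 0 b', HasDerivWithinAt g (v (g t)) (Icc 0 b') t)
    (hgB : ∀ t ∈ Icc 0 b', g t ∈ B)
    (htrans : ∀ r : ℝ, κ * |r| ≤ ‖g b' - f b - r • v₀‖) :
    dist (f b) (g b') ≤ Real.exp K * (1 + 2 / κ * (‖v₀‖ + κ / 2)) * dist (f 0) (g 0) := by
  -- Exchanging the two curves replaces `r` by `-r` in the transversality hypothesis.
  wlog hle : b ≤ b' generalizing f g b b'
  · rw [dist_comm (f b), dist_comm (f 0)]
    refine this hb' hb1' hb hb1 hg hgB hf hfB (fun r => ?_) (le_of_not_ge hle)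
    have h := htrans (-r)
    rwa [abs_neg, ← norm_neg, show -(g b' - f b - -r • v₀) = f b - g b' - r • v₀ by
      rw [neg_smul]; abel] at h
  have hsub : Icc 0 b ⊆ Icc 0 b' := Icc_subset_Icc le_rfl hle
  -- Grönwall compares the curves at the common time `b`; what remains is the excess time `b' - b`.
  have hd : dist (f b) (g b) ≤ dist (f 0) (g 0) * Real.exp (K * (b - 0)) := by
    refine dist_le_of_trajectories_ODE_of_mem (v := fun _ => v) (s := fun _ => B) (a := 0) (b := b)
      (fun _ _ => hv) (fun t ht => (hf t ht).continuousWithinAt)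
      (fun t ht => (hf t ⟨ht.1, ht.2.le⟩).mono_of_mem_nhdsWithin ?_)
      (fun t ht => hfB t ⟨ht.1, ht.2.le⟩)
      (fun t ht => ((hg t (hsub ht)).continuousWithinAt).mono hsub)
      (fun t ht => (hg t (hsub ⟨ht.1, ht.2.le⟩)).mono_of_mem_nhdsWithin ?_)
      (fun t ht => hgB t (hsub ⟨ht.1, ht.2.le⟩)) le_rfl b ⟨hb, le_rfl⟩
    · exact mem_of_superset (Icc_mem_nhdsGE ht.2) (Icc_subset_Icc ht.1 le_rfl)
    · exact mem_of_superset (Icc_mem_nhdsGE ht.2) (Icc_subset_Icc ht.1 hle)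
  have hd' : dist (f b) (g b) ≤ Real.exp K * dist (f 0) (g 0) := by
    refine hd.trans ?_
    rw [mul_comm]
    gcongr
    have : (0 : ℝ) ≤ K := K.2
    nlinarith
  have hmv : ‖(g b' - b' • v₀) - (g b - b • v₀)‖ ≤ κ / 2 * ‖b' - b‖ := by
    refine (convex_Icc 0 b').norm_image_sub_le_of_norm_hasDerivWithin_le
      (f := fun t => g t - t • v₀) (f' := fun t => v (g t) - v₀) (fun t ht => ?_)
      (fun t ht => hnear _ (hgB t ht)) ⟨hb, hle⟩ ⟨hb', le_rfl⟩
    have h1 := (hasDerivWithinAt_id t (Icc 0 b')).smul_const v₀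
    rw [one_smul] at h1
    exact (hg t ht).sub h1
  rw [Real.norm_eq_abs, abs_of_nonneg (sub_nonneg.2 hle)] at hmv
  set δ := Real.exp K * dist (f 0) (g 0)
  -- Transversality is applied with `r = b' - b`. The field differs from `v₀` by at most `κ / 2`, so
  -- half of the left side absorbs the resulting error.
  have h1 : κ * (b' - b) ≤ κ / 2 * (b' - b) + δ := by
    have h2 := htrans (b' - b)
    rw [abs_of_nonneg (sub_nonneg.2 hle)] at h2
    refine h2.trans ?_
    have h3 : g b' - f b - (b' - b) • v₀ = ((g b' - b' • v₀) - (g b - b • v₀)) + (g b - f b) := by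
      rw [sub_smul]; abel
    rw [h3]
    refine (norm_add_le _ _).trans (add_le_add hmv ?_)
    rw [← dist_eq_norm, dist_comm]; exact hd'
  have h2 : b' - b ≤ 2 / κ * δ := by
    rw [div_mul_eq_mul_div, le_div_iff₀ hκ]; linarith
  have h3 : dist (g b) (g b') ≤ (‖v₀‖ + κ / 2) * (b' - b) := by
    rw [dist_comm, dist_eq_norm]
    have : g b' - g b = ((g b' - b' • v₀) - (g b - b • v₀)) + (b' - b) • v₀ := by
      rw [sub_smul]; abel
    rw [this]
    refine (norm_add_le _ _).trans ?_
    rw [norm_smul, Real.norm_eq_abs, abs_of_nonneg (sub_nonneg.2 hle)]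
    linarith
  calc dist (f b) (g b') ≤ dist (f b) (g b) + dist (g b) (g b') := dist_triangle _ _ _
    _ ≤ δ + (‖v₀‖ + κ / 2) * (2 / κ * δ) := by gcongr; exact h3.trans (by gcongr)
    _ = _ := by simp only [δ]; ring

end NormedSpaces

/-! ### Hausdorff dimension of subsets of manifolds -/

section ManifoldDimension

variable {E : Type*} [NormedAddCommGroup E] [NormedSpace ℝ E]
  {H : Type*} [TopologicalSpace H] (I : ModelWithCorners ℝ E H)
  {M : Type*} [TopologicalSpace M] [ChartedSpace H M]
  {E' : Type*} [NormedAddCommGroup E'] [NormedSpace ℝ E']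
  {H' : Type*} [TopologicalSpace H'] (I' : ModelWithCorners ℝ E' H')
  {M' : Type*} [TopologicalSpace M'] [ChartedSpace H' M']

/-- The subset `A` of a manifold has Hausdorff dimension at most `δ`, measured in charts. -/
def MDimLE (A : Set M) (δ : ENNReal) : Prop :=
  ∀ x : M, dimH (extChartAt I x '' (A ∩ (extChartAt I x).source)) ≤ δ

variable {I I'} {A B : Set M} {δ : ENNReal}

theorem MDimLE.mono (hB : MDimLE I B δ) (h : A ⊆ B) : MDimLE I A δ := fun x =>
  (dimH_mono (image_mono (inter_subset_inter_left _ h))).trans (hB x)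

theorem MDimLE.iUnion {κ : Type*} [Countable κ] {A : κ → Set M} (h : ∀ k, MDimLE I (A k) δ) :
    MDimLE I (⋃ k, A k) δ := fun x => by
  rw [iUnion_inter, image_iUnion, dimH_iUnion]
  exact iSup_le fun k => h k x

/-- The dimension can be measured in any chart. -/
theorem MDimLE.of_chart [FiniteDimensional ℝ E] [IsManifold I 1 M] {y : M}
    (hA : A ⊆ (extChartAt I y).source) (h : dimH (extChartAt I y '' A) ≤ δ) : MDimLE I A δ := by
  intro x
  have hsub : extChartAt I x '' (A ∩ (extChartAt I x).source) =
      (extChartAt I x ∘ (extChartAt I y).symm) ''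
        (extChartAt I y '' (A ∩ (extChartAt I x).source)) := by
    rw [image_image]
    refine image_congr fun p hp => ?_
    simp only [comp_apply]
    rw [(extChartAt I y).left_inv (hA hp.1)]
  rw [hsub]
  refine (dimH_image_le_of_locally_lipschitzOn ?_).trans
    ((dimH_mono (image_mono inter_subset_left)).trans h)
  rintro _ ⟨p, hp, rfl⟩
  -- Coordinate changes are `C¹` on the convex range of the model, hence locally Lipschitz.
  have hc : ContDiffWithinAt ℝ 1 (extChartAt I x ∘ (extChartAt I y).symm) (range I)
      (extChartAt I y p) := by
    refine contDiffWithinAt_ext_coord_change x y ?_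
    rw [PartialEquiv.trans_source, PartialEquiv.symm_source]
    refine ⟨(extChartAt I y).map_source (hA hp.1), ?_⟩
    rw [mem_preimage, (extChartAt I y).left_inv (hA hp.1)]
    exact hp.2
  obtain ⟨C, t, ht, hL⟩ := hc.exists_lipschitzOnWith I.convex_range
  refine ⟨C, t, nhdsWithin_mono _ ?_ ht, hL⟩
  rintro _ ⟨z, -, rfl⟩
  rw [extChartAt_coe]
  exact mem_range_self _

/-- Relations that are Lipschitz in charts do not increase the dimension. -/
theorem MDimLE.relation_image [FiniteDimensional ℝ E'] [IsManifold I' 1 M'] {r : M → M' → Prop}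
    {x : M} {y : M'} {L : ℝ}
    (hx : ∀ a b, r a b → a ∈ (extChartAt I x).source)
    (hy : ∀ a b, r a b → b ∈ (extChartAt I' y).source)
    (hr : ∀ a b a' b', r a b → r a' b' →
      dist (extChartAt I' y b) (extChartAt I' y b') ≤
        L * dist (extChartAt I x a) (extChartAt I x a'))
    (hA : MDimLE I A δ) : MDimLE I' {b | ∃ a ∈ A, r a b} δ := by
  refine MDimLE.of_chart (y := y) (fun b ⟨a, _, hab⟩ => hy a b hab) ?_
  have h := dimH_relation_image_le
    (r := fun u v => ∃ a b, r a b ∧ extChartAt I x a = u ∧ extChartAt I' y b = v) (L := L)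
    (by
      rintro _ _ _ _ ⟨a, b, hab, rfl, rfl⟩ ⟨a', b', hab', rfl, rfl⟩
      exact hr _ _ _ _ hab hab')
    (extChartAt I x '' (A ∩ (extChartAt I x).source))
  refine (dimH_mono ?_).trans (h.trans (hA x))
  rintro _ ⟨b, ⟨a, ha, hab⟩, rfl⟩
  exact ⟨_, ⟨a, ⟨ha, hx a b hab⟩, rfl⟩, a, b, hab, rfl, rfl⟩

end ManifoldDimension

/-! ### Vector fields in charts -/

section ChartVectorField

variable {E : Type*} [NormedAddCommGroup E] [NormedSpace ℝ E]
  {H : Type*} [TopologicalSpace H] {I : ModelWithCorners ℝ E H}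
  {M : Type*} [TopologicalSpace M] [ChartedSpace H M] [IsManifold I 1 M]

/-- A vector field, expressed in the extended chart at `x₀`. -/
noncomputable def chartField (v : (x : M) → TangentSpace I x) (x₀ : M) (y : E) : E :=
  tangentCoordChange I ((extChartAt I x₀).symm y) x₀ ((extChartAt I x₀).symm y)
    (v ((extChartAt I x₀).symm y))

variable {v : (x : M) → TangentSpace I x}

theorem chartField_self (x₀ : M) : chartField v x₀ (extChartAt I x₀ x₀) = v x₀ := by
  unfold chartField
  rw [extChartAt_to_inv]
  exact tangentCoordChange_self (mem_extChartAt_source x₀)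

theorem contDiffWithinAt_chartField
    (hv : ContMDiff I I.tangent 1 (fun x => (⟨x, v x⟩ : TangentBundle I M))) (x₀ : M) :
    ContDiffWithinAt ℝ 1 (chartField v x₀) (range I) (extChartAt I x₀ x₀) := by
  have h := (contMDiffAt_iff.1 (hv x₀)).2
  exact h.snd

/-- This turns integral curves into solutions of an ODE in the model space, where Grönwall's
inequality applies. -/
theorem HasMFDerivWithinAt.hasDerivWithinAt_chart {γ : ℝ → M} {s : Set ℝ} {t : ℝ}
    (hγ : HasMFDerivWithinAt 𝓘(ℝ, ℝ) I γ s t ((1 : ℝ →L[ℝ] ℝ).smulRight (v (γ t)))) {x₀ : M}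
    (hsrc : γ t ∈ (extChartAt I x₀).source) :
    HasDerivWithinAt (extChartAt I x₀ ∘ γ) (chartField v x₀ (extChartAt I x₀ (γ t))) s t := by
  unfold chartField
  rw [(extChartAt I x₀).left_inv hsrc]
  replace hsrc := extChartAt_source I x₀ ▸ hsrc
  let w : E := v (γ t)
  have h0 := hasMFDerivWithinAt_extChartAt (I := I) (s := γ '' s) hsrc
  rw [mfderiv_chartAt_eq_tangentCoordChange hsrc] at h0
  have h : HasFDerivWithinAt (extChartAt I x₀ ∘ γ)
      ((tangentCoordChange I (γ t) x₀ (γ t)).comp ((1 : ℝ →L[ℝ] ℝ).smulRight w)) s t :=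
    hasMFDerivWithinAt_iff_hasFDerivWithinAt.1
      (HasMFDerivWithinAt.comp t h0 hγ (Set.subset_preimage_image _ _))
  refine h.hasDerivWithinAt.congr_deriv ?_
  change tangentCoordChange I (γ t) x₀ (γ t) ((1 : ℝ) • w) = tangentCoordChange I (γ t) x₀ (γ t) w
  rw [one_smul]

/-- Near each point there is a chart domain on which a vector field is Lipschitz and almost
constant. -/
theorem exists_isOpen_lipschitzOnWith_chartField
    (hv : ContMDiff I I.tangent 1 (fun x => (⟨x, v x⟩ : TangentBundle I M))) (x₀ : M)
    {ε : ℝ} (hε : 0 < ε) :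
    ∃ K : NNReal, ∃ O : Set M, IsOpen O ∧ x₀ ∈ O ∧ O ⊆ (extChartAt I x₀).source ∧
      LipschitzOnWith K (chartField v x₀) (extChartAt I x₀ '' O) ∧
      ∀ y ∈ extChartAt I x₀ '' O, ‖chartField v x₀ y - chartField v x₀ (extChartAt I x₀ x₀)‖ ≤ ε := by
  have hc := contDiffWithinAt_chartField hv x₀
  obtain ⟨K, t, ht, hL⟩ := hc.exists_lipschitzOnWith I.convex_range
  have h2 : {y | ‖chartField v x₀ y - chartField v x₀ (extChartAt I x₀ x₀)‖ ≤ ε} ∈ 𝓝[range I] (extChartAt I x₀ x₀) := by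
    have h3 := hc.continuousWithinAt.tendsto
    have h4 := h3 (Metric.closedBall_mem_nhds _ hε)
    filter_upwards [h4] with y hy
    simpa [dist_eq_norm] using hy
  have h5 : (extChartAt I x₀) ⁻¹' (t ∩ {y | ‖chartField v x₀ y - chartField v x₀ (extChartAt I x₀ x₀)‖ ≤ ε}) ∈ 𝓝 x₀ := by
    rw [← map_extChartAt_nhds x₀] at ht h2
    exact inter_mem ht h2
  obtain ⟨O, hO, hOo, hxO⟩ := mem_nhds_iff.1 (inter_mem h5 (extChartAt_source_mem_nhds (I := I) x₀))
  refine ⟨K, O, hOo, hxO, fun p hp => (hO hp).2, hL.mono ?_, ?_⟩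
  · rintro _ ⟨p, hp, rfl⟩; exact (hO hp).1.1
  · rintro _ ⟨p, hp, rfl⟩; exact (hO hp).1.2

end ChartVectorField

theorem IsMIntegralCurveOn.comp_add_Icc {E : Type*} [NormedAddCommGroup E] [NormedSpace ℝ E]
    {H : Type*} [TopologicalSpace H] {I : ModelWithCorners ℝ E H}
    {M : Type*} [TopologicalSpace M] [ChartedSpace H M] {v : (x : M) → TangentSpace I x}
    {c : ℝ → M} {a b d : ℝ} (hc : IsMIntegralCurveOn c v (Icc a b)) :
    IsMIntegralCurveOn (fun t => c (t + d)) v (Icc (a - d) (b - d)) :=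
  (hc.comp_add d).mono fun t ht => ⟨by linarith [ht.1], by linarith [ht.2]⟩

/-! ### Flows and transverse hits do not raise dimension -/

section FlowDimension

variable {E : Type*} [NormedAddCommGroup E] [NormedSpace ℝ E] [FiniteDimensional ℝ E]
  {H : Type*} [TopologicalSpace H] {I : ModelWithCorners ℝ E H}
  {M : Type*} [TopologicalSpace M] [ChartedSpace H M] [IsManifold I 1 M]
  {v : (x : M) → TangentSpace I x} {A : Set M} {δ : ENNReal}

/-- Flowing for a fixed time inside a chart domain on which the field is Lipschitz does not
increase the dimension. -/
theorem MDimLE.flow_time_in_chart {x₀ : M} {K : NNReal} {O : Set M}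
    (hO : O ⊆ (extChartAt I x₀).source)
    (hK : LipschitzOnWith K (chartField v x₀) (extChartAt I x₀ '' O)) {q : ℝ} (hq : 0 ≤ q)
    (hA : MDimLE I A δ) :
    MDimLE I {p | ∃ a ∈ A, ∃ c : ℝ → M, IsMIntegralCurveOn c v (Icc 0 q) ∧
      (∀ t ∈ Icc 0 q, c t ∈ O) ∧ c 0 = a ∧ c q = p} δ := by
  refine hA.relation_image (x := x₀) (y := x₀) (L := Real.exp (K * q)) ?_ ?_ ?_
  · rintro _ _ ⟨c, -, hc, rfl, rfl⟩; exact hO (hc 0 ⟨le_rfl, hq⟩)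
  · rintro _ _ ⟨c, -, hc, rfl, rfl⟩; exact hO (hc q ⟨hq, le_rfl⟩)
  · rintro _ _ _ _ ⟨c, hc, hcO, rfl, rfl⟩ ⟨c', hc', hcO', rfl, rfl⟩
    have key : ∀ c : ℝ → M, IsMIntegralCurveOn c v (Icc 0 q) → (∀ t ∈ Icc 0 q, c t ∈ O) →
        ∀ t ∈ Icc 0 q, HasDerivWithinAt (extChartAt I x₀ ∘ c)
          (chartField v x₀ ((extChartAt I x₀ ∘ c) t)) (Icc 0 q) t := fun c hc hcO t ht =>
      (hc t ht).hasDerivWithinAt_chart (hO (hcO t ht))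
    have h := dist_le_of_trajectories_ODE_of_mem (v := fun _ => chartField v x₀)
      (s := fun _ => extChartAt I x₀ '' O) (a := 0) (b := q) (K := K)
      (f := extChartAt I x₀ ∘ c) (g := extChartAt I x₀ ∘ c')
      (fun _ _ => hK) (fun t ht => (key c hc hcO t ht).continuousWithinAt)
      (fun t ht => (key c hc hcO t ⟨ht.1, ht.2.le⟩).mono_of_mem_nhdsWithin
        (mem_of_superset (Icc_mem_nhdsGE ht.2) (Icc_subset_Icc ht.1 le_rfl)))
      (fun t ht => mem_image_of_mem _ (hcO t ⟨ht.1, ht.2.le⟩))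
      (fun t ht => (key c' hc' hcO' t ht).continuousWithinAt)
      (fun t ht => (key c' hc' hcO' t ⟨ht.1, ht.2.le⟩).mono_of_mem_nhdsWithin
        (mem_of_superset (Icc_mem_nhdsGE ht.2) (Icc_subset_Icc ht.1 le_rfl)))
      (fun t ht => mem_image_of_mem _ (hcO' t ⟨ht.1, ht.2.le⟩)) le_rfl q ⟨hq, le_rfl⟩
    rw [sub_zero] at h
    rw [mul_comm]
    exact h

/-- Flowing for a fixed time does not increase the dimension. -/
theorem MDimLE.flow_time [SecondCountableTopology M]
    (hv : ContMDiff I I.tangent 1 (fun x => (⟨x, v x⟩ : TangentBundle I M))) {q : ℝ} (hq : 0 ≤ q)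
    (hA : MDimLE I A δ) :
    MDimLE I {p | ∃ c : ℝ → M, IsMIntegralCurveOn c v (Icc 0 q) ∧ c 0 ∈ A ∧ c q = p} δ := by
  choose K O hOo hxO hOs hOK _ using
    fun x₀ : M => exists_isOpen_lipschitzOnWith_chartField hv x₀ one_pos
  obtain ⟨s, hs, hcov⟩ := TopologicalSpace.countable_cover_nhds
    (fun x => (hOo x).mem_nhds (hxO x))
  have := hs.to_subtype
  -- One step flows for time `h` inside one of countably many chart domains. Every integral curve on
  -- `[0, q]` is a chain of `n + 1` steps of length `q / (n + 1)` for some `n`, by a Lebesgue number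
  -- argument.
  let step : ℝ → Set M → Set M := fun h B => ⋃ k : s, {p | ∃ a ∈ B, ∃ c : ℝ → M,
    IsMIntegralCurveOn c v (Icc 0 h) ∧ (∀ t ∈ Icc 0 h, c t ∈ O k) ∧ c 0 = a ∧ c h = p}
  have hstep : ∀ h, 0 ≤ h → ∀ i : ℕ, MDimLE I ((step h)^[i] A) δ := by
    intro h hh i
    induction i with
    | zero => exact hA
    | succ i ih =>
      rw [iterate_succ_apply']
      exact MDimLE.iUnion fun k => ih.flow_time_in_chart (hOs k) (hOK k) hh
  refine (MDimLE.iUnion (κ := ℕ) (A := fun n => (step (q / (n + 1)))^[n + 1] A)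
    fun n => hstep _ (by positivity) _).mono ?_
  rintro p ⟨c, hc, hcA, rfl⟩
  -- Composing with `projIcc` extends the curve continuously to all of `ℝ`, so that the preimages of
  -- the chart domains are open.
  have hcont : Continuous (c ∘ (fun t => (projIcc 0 q hq t : ℝ))) := by
    refine hc.continuousOn.comp_continuous (by fun_prop) fun t => (projIcc 0 q hq t).2
  have hproj : ∀ t ∈ Icc 0 q, (projIcc 0 q hq t : ℝ) = t := fun t ht => by
    rw [projIcc_of_mem hq ht]
  obtain ⟨ε, hε, hL⟩ := lebesgue_number_lemma_of_metric (isCompact_Icc (a := 0) (b := q))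
    (c := fun k : s => (c ∘ (fun t => (projIcc 0 q hq t : ℝ))) ⁻¹' (O k))
    (fun k => (hOo k).preimage hcont)
    (fun t _ => by
      have : c (projIcc 0 q hq t) ∈ ⋃ x ∈ s, O x := by rw [hcov]; trivial
      obtain ⟨x, hx, hmem⟩ := mem_iUnion₂.1 this
      exact mem_iUnion.2 ⟨⟨x, hx⟩, hmem⟩)
  obtain ⟨n, hn⟩ := exists_nat_gt (q / ε)
  rw [div_lt_iff₀ hε] at hn
  set h := q / (n + 1) with hh
  have hn0 : (0 : ℝ) < n + 1 := by positivity
  have hh0 : 0 ≤ h := by positivity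
  have hhε : h < ε := by rw [hh, div_lt_iff₀ hn0]; nlinarith
  have hqh : q = (n + 1) * h := by rw [hh]; field_simp
  refine mem_iUnion.2 ⟨n, ?_⟩
  have main : ∀ i : ℕ, i ≤ n + 1 → c (i * h) ∈ (step h)^[i] A := by
    intro i
    induction i with
    | zero => intro _; simpa using hcA
    | succ i ih =>
      intro hi
      rw [iterate_succ_apply']
      have hi' : (i : ℝ) + 1 ≤ n + 1 := by exact_mod_cast hi
      have hib : ((i : ℝ) + 1) * h ≤ q := by rw [hqh]; gcongr
      have hi0 : 0 ≤ (i : ℝ) * h := by positivity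
      obtain ⟨k, hk⟩ := hL (i * h) ⟨hi0, by nlinarith⟩
      refine mem_iUnion.2 ⟨k, c (i * h), ih (by omega), fun t => c (t + i * h), ?_, ?_, ?_, ?_⟩
      · refine (hc.comp_add_Icc (d := i * h)).mono (Icc_subset_Icc ?_ ?_) <;> nlinarith
      · intro t ht
        have h1 : t + i * h ∈ Icc 0 q := ⟨by linarith [ht.1], by nlinarith [ht.2]⟩
        have h2 := hk (a := t + i * h) (by
          rw [Metric.mem_ball, Real.dist_eq, add_sub_cancel_right, abs_of_nonneg ht.1]
          linarith [ht.2])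
        simp only [mem_preimage, comp_apply, hproj _ h1] at h2
        exact h2
      · simp
      · push_cast; congr 1; ring
  have h2 := main (n + 1) le_rfl
  push_cast at h2
  rwa [← hqh] at h2

/-- The points at which integral curves hit a set `S` that is transverse to the field near `e₀`:
the dimension does not increase. -/
theorem exists_nhds_MDimLE_hit [SecondCountableTopology M]
    (hv : ContMDiff I I.tangent 1 (fun x => (⟨x, v x⟩ : TangentBundle I M))) {e₀ : M} {S : Set M}
    {κ : ℝ} (hκ : 0 < κ)
    (hS : ∀ e ∈ S, ∀ e' ∈ S, ∀ r : ℝ, κ * |r| ≤ ‖extChartAt I e₀ e' - extChartAt I e₀ e -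
      r • chartField v e₀ (extChartAt I e₀ e₀)‖) :
    ∃ O ∈ 𝓝 e₀, ∀ (A : Set M) (δ : ENNReal), MDimLE I A δ →
      MDimLE I {p | p ∈ S ∩ O ∧ ∃ (c : ℝ → M) (b : ℝ), 0 ≤ b ∧
        IsMIntegralCurveOn c v (Icc 0 b) ∧ c 0 ∈ A ∧ c b = p} δ := by
  obtain ⟨K, O, hO, heO, hOs, hOK, hOv⟩ :=
    exists_isOpen_lipschitzOnWith_chartField hv e₀ (half_pos hκ)
  refine ⟨O, hO.mem_nhds heO, fun A δ hA => ?_⟩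
  -- The final stretch before the hit: it lasts at most unit time and stays in `O`, where the
  -- Lipschitz hitting estimate is available.
  let r : M → M → Prop := fun a p => ∃ (c : ℝ → M) (b : ℝ), 0 ≤ b ∧ b ≤ 1 ∧
    IsMIntegralCurveOn c v (Icc 0 b) ∧ (∀ t ∈ Icc 0 b, c t ∈ O) ∧ c 0 = a ∧ c b = p ∧ p ∈ S
  have hr : ∀ A : Set M, MDimLE I A δ → MDimLE I {p | ∃ a ∈ A, r a p} δ := by
    intro A hA
    refine hA.relation_image (x := e₀) (y := e₀) ?_ ?_ ?_ (L := Real.exp K * (1 + 2 / κ *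
      (‖chartField v e₀ (extChartAt I e₀ e₀)‖ + κ / 2)))
    · rintro _ _ ⟨c, b, hb, -, -, hc, rfl, rfl, -⟩; exact hOs (hc 0 ⟨le_rfl, hb⟩)
    · rintro _ _ ⟨c, b, hb, -, -, hc, rfl, rfl, -⟩; exact hOs (hc b ⟨hb, le_rfl⟩)
    · rintro _ _ _ _ ⟨c, b, hb, hb1, hc, hcO, rfl, rfl, hp⟩
        ⟨c', b', hb', hb1', hc', hcO', rfl, rfl, hp'⟩
      exact dist_transverse_hit_le hOK hκ hOv hb hb1 hb' hb1'
        (f := extChartAt I e₀ ∘ c) (g := extChartAt I e₀ ∘ c')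
        (fun t ht => (hc t ht).hasDerivWithinAt_chart (hOs (hcO t ht)))
        (fun t ht => mem_image_of_mem _ (hcO t ht))
        (fun t ht => (hc' t ht).hasDerivWithinAt_chart (hOs (hcO' t ht)))
        (fun t ht => mem_image_of_mem _ (hcO' t ht)) (hS _ hp _ hp')
  -- Each curve is cut shortly before the hit, at a rational time, so that only countably many
  -- fixed-time flows occur.
  refine (MDimLE.iUnion (κ := {q : ℚ // 0 ≤ q}) fun q =>
    hr _ (hA.flow_time hv (q := (q : ℚ)) (by exact_mod_cast q.2))).mono ?_
  rintro p ⟨⟨hpS, hpO⟩, c, b, hb, hc, hcA, rfl⟩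
  obtain ⟨q, hq0, hqb, hqb1, hqO⟩ : ∃ q : ℚ, 0 ≤ q ∧ (q : ℝ) ≤ b ∧ b - q ≤ 1 ∧
      ∀ t ∈ Icc (q : ℝ) b, c t ∈ O := by
    rcases hb.eq_or_lt with rfl | hb
    · refine ⟨0, le_rfl, by simp, by simp, fun t ht => ?_⟩
      rw [Rat.cast_zero, Icc_self, mem_singleton_iff] at ht
      rwa [ht]
    · have h1 : c ⁻¹' O ∈ 𝓝[Icc 0 b] b :=
        (hc.continuousOn b ⟨hb.le, le_rfl⟩) (hO.mem_nhds hpO)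
      obtain ⟨ε, hε, hεO⟩ := Metric.mem_nhdsWithin_iff.1 h1
      obtain ⟨q, hq1, hq2⟩ := exists_rat_btwn (show max (max 0 (b - 1)) (b - ε) < b by
        simp [hb, hε])
      rw [max_lt_iff, max_lt_iff] at hq1
      refine ⟨q, by exact_mod_cast hq1.1.1.le, hq2.le, by linarith, fun t ht => hεO ⟨?_, ?_⟩⟩
      · rw [Metric.mem_ball, Real.dist_eq, abs_lt]; constructor <;> linarith [ht.1, ht.2]
      · exact ⟨by linarith [ht.1], ht.2⟩
  have hq0' : (0 : ℝ) ≤ q := by exact_mod_cast hq0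
  refine mem_iUnion.2 ⟨⟨q, hq0⟩, c q, ⟨c, hc.mono (Icc_subset_Icc le_rfl hqb), hcA, rfl⟩,
    fun t => c (t + q), b - q, by linarith, hqb1, ?_, ?_, by simp, by simp, hpS⟩
  · exact (hc.comp_add_Icc (d := q)).mono (Icc_subset_Icc (by linarith) le_rfl)
  · exact fun t ht => hqO _ ⟨by linarith [ht.1], by linarith [ht.2]⟩

end FlowDimension

/-! ### Forward uniqueness of integral curves -/

section ForwardGerms

variable {E : Type*} [NormedAddCommGroup E] [NormedSpace ℝ E]
  {H : Type*} [TopologicalSpace H] {I : ModelWithCorners ℝ E H}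
  {M : Type*} [TopologicalSpace M] [ChartedSpace H M]

/-- The germ of `c` to the right of `a` is an integral curve of `v`, starting at `c a`. -/
def IsForwardCurve (c : ℝ → M) (v : (x : M) → TangentSpace I x) (a : ℝ) : Prop :=
  ContinuousWithinAt c (Ici a) a ∧
    ∀ᶠ t in 𝓝[>] a, HasMFDerivAt 𝓘(ℝ, ℝ) I c t ((1 : ℝ →L[ℝ] ℝ).smulRight (v (c t)))

variable {v : (x : M) → TangentSpace I x} {c c' : ℝ → M} {a b : ℝ}

theorem IsMIntegralCurveOn.isForwardCurve (hc : IsMIntegralCurveOn c v (Icc a b)) {t : ℝ}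
    (ht : t ∈ Ico a b) : IsForwardCurve c v t := by
  refine ⟨(hc.continuousOn t ⟨ht.1, ht.2.le⟩).mono_of_mem_nhdsWithin
    (mem_of_superset (Icc_mem_nhdsGE ht.2) (Icc_subset_Icc ht.1 le_rfl)), ?_⟩
  filter_upwards [Ioo_mem_nhdsGT ht.2] with s hs
  exact (hc s ⟨ht.1.trans hs.1.le, hs.2.le⟩).hasMFDerivAt
    (Icc_mem_nhds (ht.1.trans_lt hs.1) hs.2)

variable [IsManifold I 1 M]

/-- The definition asks only for continuity at `a`. The right derivative there is the limit of the
derivatives at later times, which exists because the field is continuous in the chart; hence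
boundary points need no separate treatment. -/
theorem IsForwardCurve.eventually_chart
    (hv : ContMDiff I I.tangent 1 (fun x => (⟨x, v x⟩ : TangentBundle I M)))
    (hc : IsForwardCurve c v a) :
    ∀ᶠ b in 𝓝[>] a, ContinuousOn (extChartAt I (c a) ∘ c) (Icc a b) ∧
      ∀ t ∈ Ico a b, HasDerivWithinAt (extChartAt I (c a) ∘ c)
        (chartField v (c a) (extChartAt I (c a) (c t))) (Ici t) t := by
  set φ := extChartAt I (c a)
  have hsrc : ∀ᶠ t in 𝓝[>] a, c t ∈ φ.source :=
    (hc.1.mono Ioi_subset_Ici_self) (extChartAt_source_mem_nhds (c a))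
  have hder : ∀ᶠ t in 𝓝[>] a, HasDerivAt (φ ∘ c) (chartField v (c a) (φ (c t))) t := by
    filter_upwards [hsrc, hc.2] with t ht hd
    rw [← hasDerivWithinAt_univ]
    exact (hd.hasMFDerivWithinAt (s := univ)).hasDerivWithinAt_chart ht
  have hca : ContinuousWithinAt (φ ∘ c) (Ici a) a :=
    (continuousAt_extChartAt (c a)).comp_continuousWithinAt hc.1
  have hright : HasDerivWithinAt (φ ∘ c) (chartField v (c a) (φ (c a))) (Ici a) a := by
    refine hasDerivWithinAt_Ici_of_tendsto_deriv (s := {t | HasDerivAt (φ ∘ c)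
      (chartField v (c a) (φ (c t))) t} ∩ Ioi a)
      (fun t ht => ht.1.differentiableAt.differentiableWithinAt)
      (hca.mono fun t ht => mem_Ici.2 (le_of_lt ht.2)) (inter_mem hder self_mem_nhdsWithin) ?_
    · have hV := (contDiffWithinAt_chartField hv (c a)).continuousWithinAt
      have h1 : Tendsto (fun t => chartField v (c a) (φ (c t))) (𝓝[>] a)
          (𝓝 (chartField v (c a) (φ (c a)))) := by
        refine hV.tendsto.comp (tendsto_nhdsWithin_iff.2
          ⟨hca.mono Ioi_subset_Ici_self, Eventually.of_forall fun t => ?_⟩)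
        simp only [φ, extChartAt_coe]
        exact mem_range_self _
      refine h1.congr' ?_
      filter_upwards [hder] with t ht using ht.deriv.symm
  obtain ⟨b₀, hb₀, hsub⟩ := mem_nhdsGT_iff_exists_Ioo_subset.1 hder
  filter_upwards [Ioo_mem_nhdsGT hb₀] with b hb
  have hloc : ∀ t ∈ Ioc a b, HasDerivAt (φ ∘ c) (chartField v (c a) (φ (c t))) t :=
    fun t ht => hsub ⟨ht.1, ht.2.trans_lt hb.2⟩
  constructor
  · intro t ht
    rcases ht.1.eq_or_lt with rfl | hat
    · exact hca.mono Icc_subset_Ici_self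
    · exact (hloc t ⟨hat, ht.2⟩).continuousAt.continuousWithinAt
  · intro t ht
    rcases ht.1.eq_or_lt with rfl | hat
    · exact hright
    · exact (hloc t ⟨hat, ht.2.le⟩).hasDerivWithinAt

/-- Forward uniqueness of integral curves, also at the boundary. -/
theorem IsForwardCurve.eventuallyEq
    (hv : ContMDiff I I.tangent 1 (fun x => (⟨x, v x⟩ : TangentBundle I M)))
    (hc : IsForwardCurve c v a) (hc' : IsForwardCurve c' v a) (h : c a = c' a) :
    c =ᶠ[𝓝[≥] a] c' := by
  obtain ⟨K, O, hO, haO, hOs, hK, -⟩ := exists_isOpen_lipschitzOnWith_chartField hv (c a) one_pos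
  have h1 : ∀ᶠ t in 𝓝[≥] a, c t ∈ O := hc.1 (hO.mem_nhds haO)
  have h2 : ∀ᶠ t in 𝓝[≥] a, c' t ∈ O := hc'.1 (hO.mem_nhds (h ▸ haO))
  obtain ⟨b₀, hb₀, hsub⟩ := mem_nhdsGE_iff_exists_Ico_subset.1 (h1.and h2)
  have h3 := hc'.eventually_chart hv
  rw [← h] at h3
  obtain ⟨b, ⟨⟨hf, hf'⟩, hg, hg'⟩, hab, hbb⟩ := ((hc.eventually_chart hv).and h3 |>.and
    (Ioo_mem_nhdsGT hb₀)).exists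
  have hmem : ∀ t ∈ Icc a b, c t ∈ O ∧ c' t ∈ O := fun t ht => hsub ⟨ht.1, ht.2.trans_lt hbb⟩
  filter_upwards [Icc_mem_nhdsGE hab] with t ht
  -- Grönwall with initial distance `0`.
  have h4 := dist_le_of_trajectories_ODE_of_mem (v := fun _ => chartField v (c a))
    (s := fun _ => extChartAt I (c a) '' O) (fun _ _ => hK) hf hf'
    (fun t ht => mem_image_of_mem _ (hmem t ⟨ht.1, ht.2.le⟩).1) hg hg'
    (fun t ht => mem_image_of_mem _ (hmem t ⟨ht.1, ht.2.le⟩).2)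
    (δ := 0) (by simp [h]) t ht
  rw [zero_mul, dist_le_zero] at h4
  exact (extChartAt I (c a)).injOn (hOs (hmem t ht).1) (hOs (hmem t ht).2) h4

end ForwardGerms

/-! ### Boundary points in half-space charts -/

section HalfSpace

variable {n : ℕ} [NeZero n] {M : Type*} [TopologicalSpace M]
  [ChartedSpace (EuclideanHalfSpace n) M]

theorem extChartAt_halfSpace_nonneg (x p : M) : 0 ≤ (extChartAt (𝓡∂ n) x p) 0 := by
  rw [extChartAt_coe]
  exact (chartAt (EuclideanHalfSpace n) x p).2

variable [IsManifold (𝓡∂ n) 1 M]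

/-- The boundary is given, in any chart, by the vanishing of the first coordinate. -/
theorem mem_boundary_iff_extChartAt {x p : M} (hp : p ∈ (extChartAt (𝓡∂ n) x).source) :
    p ∈ (𝓡∂ n).boundary M ↔ (extChartAt (𝓡∂ n) x p) 0 = 0 := by
  have hp' : p ∈ (chartAt (EuclideanHalfSpace n) x).source := by rwa [extChartAt_source] at hp
  have h1 : p ∈ (𝓡∂ n).boundary M ↔ ¬ (𝓡∂ n).IsInteriorPoint p :=
    (𝓡∂ n).isBoundaryPoint_iff_not_isInteriorPoint p
  have h2 : (𝓡∂ n).IsInteriorPoint p ↔ 0 < (extChartAt (𝓡∂ n) x p) 0 := by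
    rw [(𝓡∂ n).isInteriorPoint_iff_of_mem_atlas one_ne_zero (chart_mem_atlas _ x) hp']
    have h3 : extChartAt (𝓡∂ n) x p ∈ interior (range (𝓡∂ n)) ↔
        0 < (extChartAt (𝓡∂ n) x p) 0 := by
      rw [interior_range_modelWithCornersEuclideanHalfSpace]; rfl
    rw [← h3]
    constructor
    · exact fun h => OpenPartialHomeomorph.interior_extend_target_subset_interior_range _ h
    · exact fun h => (chartAt _ x).mem_interior_extend_target
        ((chartAt _ x).map_source hp') h
  rw [h1, h2, not_lt]
  exact ⟨fun h => le_antisymm h (extChartAt_halfSpace_nonneg x p), fun h => h.le⟩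

/-- The boundary of an `n`-dimensional manifold has dimension at most `n - 1`. -/
theorem MDimLE.boundary : MDimLE (𝓡∂ n) ((𝓡∂ n).boundary M) ((n - 1 : ℕ) : ENNReal) := by
  intro x
  let l : EuclideanSpace ℝ (Fin n) →ₗ[ℝ] ℝ := (EuclideanSpace.proj (𝕜 := ℝ) (0 : Fin n)).toLinearMap
  have hl : ∀ y, l y = y 0 := fun y => rfl
  have hrank : Module.finrank ℝ (LinearMap.ker l) = n - 1 := by
    have h1 := l.finrank_range_add_finrank_ker
    have h2 : LinearMap.range l = ⊤ := by
      rw [LinearMap.range_eq_top]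
      intro r
      exact ⟨EuclideanSpace.single 0 r, by simp [hl]⟩
    rw [h2, finrank_top, Module.finrank_self, finrank_euclideanSpace_fin] at h1
    omega
  have h3 : dimH (LinearMap.ker l : Set (EuclideanSpace ℝ (Fin n))) =
      ((n - 1 : ℕ) : ENNReal) := by
    have h4 := (LinearMap.ker l).subtypeₗᵢ.isometry.dimH_image univ
    rw [image_univ, Real.dimH_univ_eq_finrank, hrank] at h4
    rw [← h4]
    congr 1
    exact Subtype.range_coe.symm
  rw [← h3]
  refine dimH_mono ?_
  rintro _ ⟨p, ⟨hp, hps⟩, rfl⟩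
  exact (mem_boundary_iff_extChartAt hps).1 hp

variable {v : (x : M) → TangentSpace (𝓡∂ n) x}

/-- An integral curve cannot start at a boundary point where the field points outward. -/
theorem IsForwardCurve.not_outward
    (hv : ContMDiff (𝓡∂ n) (𝓡∂ n).tangent 1 (fun x => (⟨x, v x⟩ : TangentBundle (𝓡∂ n) M)))
    {c : ℝ → M} {a : ℝ} (hc : IsForwardCurve c v a) (hb : c a ∈ (𝓡∂ n).boundary M) :
    ¬ chartField v (c a) (extChartAt (𝓡∂ n) (c a) (c a)) 0 < 0 := by
  obtain ⟨b, ⟨-, hd⟩, hab⟩ := ((hc.eventually_chart hv).and self_mem_nhdsWithin).exists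
  have h1 := hd a ⟨le_rfl, hab⟩
  have h2 := (EuclideanSpace.proj (𝕜 := ℝ) (0 : Fin n)).hasFDerivAt.comp_hasDerivWithinAt a h1
  rw [hasDerivWithinAt_iff_tendsto_slope, Ici_sdiff_left] at h2
  rw [not_lt]
  -- The first coordinate vanishes at time `a` and is nonnegative afterwards, so its difference
  -- quotients are nonnegative.
  refine ge_of_tendsto h2 ?_
  filter_upwards [self_mem_nhdsWithin] with t ht
  rw [slope_def_field]
  refine div_nonneg (sub_nonneg.2 ?_) (sub_nonneg.2 (le_of_lt ht))
  have h3 := (mem_boundary_iff_extChartAt (mem_extChartAt_source (I := 𝓡∂ n) (c a))).1 hb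
  have h4 := extChartAt_halfSpace_nonneg (n := n) (c a) (c t)
  change (extChartAt (𝓡∂ n) (c a) (c a)) 0 ≤ (extChartAt (𝓡∂ n) (c a) (c t)) 0
  rwa [h3]

end HalfSpace

/-- A relation out of a set `S` does not raise the dimension above `δ` if this is so locally. -/
theorem MDimLE.of_locally {X : Type*} [TopologicalSpace X] [SecondCountableTopology X]
    {E : Type*} [NormedAddCommGroup E] [NormedSpace ℝ E]
    {H : Type*} [TopologicalSpace H] {I : ModelWithCorners ℝ E H}
    {M : Type*} [TopologicalSpace M] [ChartedSpace H M] {δ : ENNReal} {S : Set X}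
    {Q : X → M → Prop}
    (h : ∀ g ∈ S, ∃ O ∈ 𝓝 g, MDimLE I {y | ∃ e ∈ S ∩ O, Q e y} δ) :
    MDimLE I {y | ∃ e ∈ S, Q e y} δ := by
  choose! O hO hQ using h
  obtain ⟨T, hTS, hT, hcov⟩ := TopologicalSpace.countable_cover_nhdsWithin
    (fun x hx => mem_nhdsWithin_of_mem_nhds (hO x hx))
  have := hT.to_subtype
  refine (MDimLE.iUnion (κ := T) fun k => hQ k (hTS k.2)).mono ?_
  rintro y ⟨e, he, hey⟩
  obtain ⟨x, hx, hex⟩ := mem_iUnion₂.1 (hcov he)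
  exact mem_iUnion.2 ⟨⟨x, hx⟩, e, ⟨he, hex⟩, hey⟩

/-! ### Dimension along arcs of a hybrid system -/

section Hybrid

universe u v

variable {J : Type v} {dim : J → ℕ} [∀ j, NeZero (dim j)] {D : J → Type u}
  [∀ j, TopologicalSpace (D j)] [∀ j, ChartedSpace (EuclideanHalfSpace (dim j)) (D j)]
  [∀ j, IsManifold (𝓡∂ (dim j)) ∞ (D j)]

namespace HybridSystem

variable {H : HybridSystem dim D}

theorem contMDiff_F (H : HybridSystem dim D) (j : J) :
    ContMDiff (𝓡∂ (dim j)) (𝓡∂ (dim j)).tangent 1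
      (fun x : D j => (⟨x, H.F j x⟩ : TangentBundle (𝓡∂ (dim j)) (D j))) :=
  (H.F_smooth j).of_le (by norm_cast)

theorem guard_subset_boundary (H : HybridSystem dim D) (j : J) :
    H.G j ⊆ (𝓡∂ (dim j)).boundary (D j) := by
  obtain ⟨O, -, hO⟩ := H.G_open j
  rw [hO]; exact inter_subset_right

/-- The preferred chart at `x` is one of the charts allowed in `OutwardPointing`, and its derivative
at `x` is the identity under the identification of the tangent space with the model space. -/
theorem OutwardPointing.chartField_neg (hout : H.OutwardPointing) {j : J} {x : D j}
    (hx : x ∈ H.G j) :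
    (chartField (H.F j) x (extChartAt (𝓡∂ (dim j)) x x)) 0 < 0 := by
  have h := hout j x hx (chartAt _ x) (IsManifold.chart_mem_maximalAtlas x) (mem_chart_source _ x)
  have h2 := mfderiv_chartAt_eq_tangentCoordChange (I := 𝓡∂ (dim j))
    (mem_chart_source (EuclideanHalfSpace (dim j)) x)
  rw [chartField_self]
  have h3 : @Eq (EuclideanSpace ℝ (Fin (dim j)))
      (mfderiv (𝓡∂ (dim j)) 𝓘(ℝ, EuclideanSpace ℝ (Fin (dim j))) (extChartAt (𝓡∂ (dim j)) x) x
        (H.F j x)) (H.F j x) := by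
    rw [(hasMFDerivAt_extChartAt (I := 𝓡∂ (dim j))
      (mem_chart_source (EuclideanHalfSpace (dim j)) x)).mfderiv, h2]
    exact tangentCoordChange_self (mem_extChartAt_source x)
  exact (congrArg (fun w : EuclideanSpace ℝ (Fin (dim j)) => w 0) h3).symm.trans_lt h

/-- No integral curve continues from a point of the guard. -/
theorem OutwardPointing.notMem_guard (hout : H.OutwardPointing) {j : J} {c : ℝ → D j} {a : ℝ}
    (hc : IsForwardCurve c (H.F j) a) : c a ∉ H.G j := fun hG =>
  hc.not_outward (H.contMDiff_F j) (H.guard_subset_boundary j hG) (hout.chartField_neg hG)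

/-- The exit points in the guard of integral curves that start in `A`. -/
theorem OutwardPointing.MDimLE_guard_hit (hout : H.OutwardPointing) {j : J}
    [SecondCountableTopology (D j)] {A : Set (D j)} {δ : ENNReal} (hA : MDimLE (𝓡∂ (dim j)) A δ) :
    MDimLE (𝓡∂ (dim j)) {p | p ∈ H.G j ∧ ∃ (c : ℝ → D j) (b : ℝ), 0 ≤ b ∧
      IsMIntegralCurveOn c (H.F j) (Icc 0 b) ∧ c 0 ∈ A ∧ c b = p} δ := by
  have key := MDimLE.of_locally (I := 𝓡∂ (dim j)) (S := H.G j) (δ := δ)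
    (Q := fun e p => e = p ∧ ∃ (c : ℝ → D j) (b : ℝ), 0 ≤ b ∧
      IsMIntegralCurveOn c (H.F j) (Icc 0 b) ∧ c 0 ∈ A ∧ c b = p) ?_
  · exact key.mono fun p ⟨hp, h⟩ => ⟨p, hp, rfl, h⟩
  intro g hg
  have hneg := hout.chartField_neg hg
  set w := chartField (H.F j) g (extChartAt (𝓡∂ (dim j)) g g)
  -- Guard points have first coordinate `0`, so the first coordinate of the difference is `-r * w
  -- 0`; this gives the constant `κ = -w 0`.
  obtain ⟨O, hO, h⟩ := exists_nhds_MDimLE_hit (H.contMDiff_F j) (e₀ := g)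
    (S := H.G j ∩ (extChartAt (𝓡∂ (dim j)) g).source) (κ := -w 0) (by linarith) (by
      rintro e ⟨he, hes⟩ e' ⟨he', hes'⟩ r
      have h1 := (mem_boundary_iff_extChartAt hes).1 (H.guard_subset_boundary j he)
      have h2 := (mem_boundary_iff_extChartAt hes').1 (H.guard_subset_boundary j he')
      refine le_trans ?_ (PiLp.norm_apply_le _ (0 : Fin (dim j)))
      change _ ≤ ‖(extChartAt (𝓡∂ (dim j)) g e') 0 - (extChartAt (𝓡∂ (dim j)) g e) 0 - r * w 0‖
      rw [h1, h2, sub_self, zero_sub, norm_neg, norm_mul, Real.norm_eq_abs, Real.norm_eq_abs,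
        abs_of_neg hneg, mul_comm])
  refine ⟨O ∩ (extChartAt (𝓡∂ (dim j)) g).source,
    inter_mem hO (extChartAt_source_mem_nhds g), (h A δ hA).mono ?_⟩
  rintro p ⟨_, ⟨hpG, hpO, hps⟩, rfl, h⟩
  exact ⟨⟨⟨hpG, hps⟩, hpO⟩, h⟩

/-- The reset map does not increase the dimension of subsets of the guard. -/
theorem MDimLE_reset {j k : J} [SecondCountableTopology (D j)] {A : Set (D j)} {δ : ENNReal}
    (hA : MDimLE (𝓡∂ (dim j)) A δ) :
    MDimLE (𝓡∂ (dim k)) {y : D k | ∃ e ∈ H.G j, e ∈ A ∧ H.R j e = ⟨k, y⟩} δ := by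
  refine MDimLE.of_locally fun g hg => ?_
  obtain ⟨k', f, hR, hf⟩ := H.R_smooth j g hg
  by_cases hk : k' = k
  swap
  -- Near `g` all resets land in `D k'`, so none lands in `D k`.
  · obtain ⟨O, hO, hgO, hsub⟩ := mem_nhdsWithin.1 hR
    refine ⟨O, hO.mem_nhds hgO, fun x => ?_⟩
    have hempty : {y : D k | ∃ e ∈ H.G j ∩ O, e ∈ A ∧ H.R j e = ⟨k, y⟩} = ∅ := by
      refine eq_empty_of_forall_notMem fun y ⟨e, he, _, hy⟩ => hk ?_
      have h1 := hsub ⟨he.2, he.1⟩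
      simp only [mem_ofPred_eq, hy] at h1
      exact (congrArg Sigma.fst h1).symm
    rw [hempty]
    simp
  subst hk
  set φ := extChartAt (𝓡∂ (dim j)) g with hφ
  set ψ := extChartAt (𝓡∂ (dim k')) (f g) with hψ
  obtain ⟨hcont, hdiff⟩ := contMDiffWithinAt_iff.1 hf
  have hg0 := (mem_boundary_iff_extChartAt (mem_extChartAt_source (I := 𝓡∂ (dim j)) g)).1
    (H.guard_subset_boundary j hg)
  -- The reset is smooth only along the guard. Since the guard is relatively open in the boundary,
  -- in the chart it fills the hyperplane `y 0 = 0` near `φ g`; this hyperplane is convex, so `C¹`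
  -- along it gives a Lipschitz bound.
  have hdiff' : ContDiffWithinAt ℝ 1 (ψ ∘ f ∘ φ.symm) {y | y 0 = 0} (φ g) := by
    refine (hdiff.of_le (by norm_cast)).mono_of_mem_nhdsWithin ?_
    obtain ⟨O, hO, hGO⟩ := H.G_open j
    have hgO : g ∈ O := by rw [hGO] at hg; exact hg.1
    have hsub : ({y | y 0 = 0} : Set (EuclideanSpace ℝ (Fin (dim j)))) ⊆ range (𝓡∂ (dim j)) := by
      rw [range_modelWithCornersEuclideanHalfSpace]; intro y hy; exact le_of_eq (Eq.symm hy)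
    have h1 : φ.target ∈ 𝓝[{y | y 0 = 0}] (φ g) :=
      nhdsWithin_mono _ hsub (extChartAt_target_mem_nhdsWithin g)
    have h2 : φ.symm ⁻¹' O ∈ 𝓝[{y | y 0 = 0}] (φ g) := by
      refine mem_nhdsWithin_of_mem_nhds ((continuousAt_extChartAt_symm g) ?_)
      rw [extChartAt_to_inv]
      exact hO.mem_nhds hgO
    filter_upwards [h1, h2, self_mem_nhdsWithin] with y hy1 hy2 hy3
    refine ⟨?_, hsub hy3⟩
    rw [mem_preimage, hGO]
    refine ⟨hy2, (mem_boundary_iff_extChartAt (φ.map_target hy1)).2 ?_⟩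
    rw [φ.right_inv hy1]
    exact hy3
  have hconv : Convex ℝ ({y | y 0 = 0} : Set (EuclideanSpace ℝ (Fin (dim j)))) := by
    intro x hx y hy a b _ _ _
    simp only [mem_ofPred_eq] at hx hy ⊢
    simp [hx, hy]
  obtain ⟨L, t, ht, hL⟩ := hdiff'.exists_lipschitzOnWith hconv
  have h1 : ∀ᶠ e in 𝓝[H.G j] g, e ∈ φ.source :=
    mem_nhdsWithin_of_mem_nhds (extChartAt_source_mem_nhds g)
  have h2 : ∀ᶠ e in 𝓝[H.G j] g, f e ∈ ψ.source := hcont (extChartAt_source_mem_nhds (f g))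
  have h3 : ∀ᶠ e in 𝓝[H.G j] g, φ e ∈ t := by
    have h4 : Tendsto φ (𝓝[H.G j] g) (𝓝[{y | y 0 = 0}] (φ g)) := by
      refine tendsto_nhdsWithin_iff.2
        ⟨(continuousAt_extChartAt g).tendsto.mono_left nhdsWithin_le_nhds, ?_⟩
      filter_upwards [h1, self_mem_nhdsWithin] with e he heG
      exact (mem_boundary_iff_extChartAt he).1 (H.guard_subset_boundary j heG)
    exact h4 ht
  obtain ⟨O, hO, hgO, hsub⟩ := mem_nhdsWithin.1 (hR.and (h1.and (h2.and h3)))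
  have hb : ∀ e ∈ H.G j ∩ O, ∀ y, H.R j e = ⟨k', y⟩ → y = f e := by
    intro e he y hy
    have h4 := (hsub ⟨he.2, he.1⟩).1
    rw [hy] at h4
    simpa using h4
  refine ⟨O, hO.mem_nhds hgO, (hA.relation_image (I' := 𝓡∂ (dim k'))
    (r := fun e y => e ∈ H.G j ∩ O ∧ H.R j e = ⟨k', y⟩) (x := g) (y := f g) (L := L) ?_ ?_ ?_).mono
    fun y ⟨e, he, heA, hey⟩ => ⟨e, heA, he, hey⟩⟩
  · exact fun e y ⟨he, hy⟩ => (hsub ⟨he.2, he.1⟩).2.1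
  · rintro e y ⟨he, hy⟩
    rw [hb e he y hy]
    exact (hsub ⟨he.2, he.1⟩).2.2.1
  · rintro e y e' y' ⟨he, hy⟩ ⟨he', hy'⟩
    have h5 := hL.dist_le_mul _ (hsub ⟨he.2, he.1⟩).2.2.2 _ (hsub ⟨he'.2, he'.1⟩).2.2.2
    simp only [comp_apply] at h5
    rw [φ.left_inv (hsub ⟨he.2, he.1⟩).2.1, φ.left_inv (hsub ⟨he'.2, he'.1⟩).2.1] at h5
    rw [hb e he y hy, hb e' he' y' hy']
    exact h5

/-- Arcs that leave an `m`-dimensional domain enter all later domains along sets of dimension at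
most `m - 1`. -/
theorem OutwardPointing.MDimLE_arc_entry (hout : H.OutwardPointing)
    [∀ j, SecondCountableTopology (D j)] {N : ℕ} {j : ℕ → J} {i m : ℕ} (hm : dim (j i) = m) :
    ∀ l, i ≤ l → l < N → MDimLE (𝓡∂ (dim (j (l + 1))))
      {p : D (j (l + 1)) | ∃ (t : ℕ → ℝ) (c : ∀ i, ℝ → D (j i)), H.IsArc N j t c ∧
        c (l + 1) (t (l + 1)) = p} ((m - 1 : ℕ) : ENNReal) := by
  have hreset : ∀ l < N, MDimLE (𝓡∂ (dim (j l))) {p : D (j l) | ∃ (t : ℕ → ℝ)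
      (c : ∀ i, ℝ → D (j i)), H.IsArc N j t c ∧ c l (t (l + 1)) = p} ((m - 1 : ℕ) : ENNReal) →
      MDimLE (𝓡∂ (dim (j (l + 1)))) {p : D (j (l + 1)) | ∃ (t : ℕ → ℝ) (c : ∀ i, ℝ → D (j i)),
        H.IsArc N j t c ∧ c (l + 1) (t (l + 1)) = p} ((m - 1 : ℕ) : ENNReal) := by
    intro l hl h
    refine (MDimLE_reset (H := H) (k := j (l + 1)) h).mono ?_
    rintro p ⟨t, c, harc, rfl⟩
    exact ⟨_, harc.exit_mem l hl, ⟨t, c, harc, rfl⟩, harc.reset l hl⟩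
  intro l hil
  induction l, hil using Nat.le_induction with
  | base =>
    -- The first exit points lie in the boundary of an `m`-dimensional domain; this is where
    -- dimension drops to `m - 1`.
    intro hl
    refine hreset i hl ?_
    rw [← hm]
    refine (MDimLE.boundary (M := D (j i))).mono ?_
    rintro p ⟨t, c, harc, rfl⟩
    exact H.guard_subset_boundary _ (harc.exit_mem i hl)
  | succ l hil ih =>
    intro hl
    refine hreset (l + 1) hl ((hout.MDimLE_guard_hit (ih (by omega))).mono ?_)
    rintro p ⟨t, c, harc, rfl⟩
    refine ⟨harc.exit_mem (l + 1) hl, fun s => c (l + 1) (s + t (l + 1)),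
      t (l + 1 + 1) - t (l + 1), ?_, ?_, ⟨t, c, harc, by simp⟩, by simp⟩
    · linarith [harc.t_le (l + 1) hl.le]
    · have h := (harc.flow (l + 1) hl.le).comp_add_Icc (d := t (l + 1))
      rwa [sub_self] at h

end HybridSystem

end Hybrid

/-! ### Executions follow arcs -/

section Executions

universe u v

variable {J : Type v} {dim : J → ℕ} [∀ j, NeZero (dim j)] {D : J → Type u}
  [∀ j, TopologicalSpace (D j)] [∀ j, ChartedSpace (EuclideanHalfSpace (dim j)) (D j)]
  [∀ j, IsManifold (𝓡∂ (dim j)) ∞ (D j)]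

namespace HybridSystem

variable {H : HybridSystem dim D} {γ : ℝ → Σ j, D j}

/-- To the right of each instant, an execution with isolated transitions is an integral curve. -/
theorem IsExecution.exists_isForwardCurve (hγ : H.IsExecution γ univ)
    (hiso : IsolatedTransitions γ) {a : ℝ} {j : J} {p : D j} (ha : γ a = ⟨j, p⟩) :
    ∃ c : ℝ → D j, c a = p ∧ (∀ᶠ s in 𝓝[≥] a, γ s = ⟨j, c s⟩) ∧
      IsForwardCurve c (H.F j) a := by
  classical
  have hcont : ContinuousWithinAt γ (Ici a) a := by
    simpa using hγ.right_continuous a (mem_univ a)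
  have hrange : ∀ᶠ s in 𝓝[≥] a, γ s ∈ range (Sigma.mk j) := by
    refine hcont (isOpen_range_sigmaMk.mem_nhds ?_)
    rw [ha]; exact mem_range_self p
  let c : ℝ → D j := fun s => if h : ∃ x, Sigma.mk j x = γ s then h.choose else p
  have hc : ∀ s, γ s ∈ range (Sigma.mk j) → γ s = ⟨j, c s⟩ := by
    intro s hs
    have hs' : ∃ x, Sigma.mk j x = γ s := hs
    simp only [c, dif_pos hs']
    exact hs'.choose_spec.symm
  have hca : c a = p := by
    have h := hc a (by rw [ha]; exact mem_range_self p)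
    rw [ha] at h
    simpa using h.symm
  have hev : ∀ᶠ s in 𝓝[≥] a, γ s = ⟨j, c s⟩ := hrange.mono hc
  refine ⟨c, hca, hev, ?_, ?_⟩
  · rw [IsInducing.continuousWithinAt_iff (IsEmbedding.sigmaMk (σ := D) (i := j)).isInducing]
    exact hcont.congr_of_eventuallyEq (hev.mono fun s hs => hs.symm) (by simp [ha, hca])
  -- The discontinuities in `[a, a + 1]` other than `a` form a finite, hence closed, set that misses
  -- `a`.
  · have hfin : ∀ᶠ s in 𝓝[>] a, ContinuousAt γ s := by
      have h1 : (({t | ¬ ContinuousAt γ t} ∩ Icc a (a + 1)) \ {a})ᶜ ∈ 𝓝 a :=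
        ((hiso a (a + 1)).sdiff.isClosed.isOpen_compl).mem_nhds (by simp)
      filter_upwards [mem_nhdsWithin_of_mem_nhds h1, Ioo_mem_nhdsGT (lt_add_one a)] with s hs hs'
      by_contra hcon
      exact hs ⟨⟨hcon, hs'.1.le, hs'.2.le⟩, hs'.1.ne'⟩
    have hev' : ∀ᶠ s in 𝓝[>] a, ∀ᶠ u in 𝓝 s, γ u = ⟨j, c u⟩ := by
      obtain ⟨b, hb, hsub⟩ := mem_nhdsGE_iff_exists_Ico_subset.1 hev
      filter_upwards [Ioo_mem_nhdsGT hb] with s hs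
      filter_upwards [Ioo_mem_nhds hs.1 hs.2] with u hu using hsub ⟨hu.1.le, hu.2⟩
    filter_upwards [hfin, hev'] with s hs1 hs2
    obtain ⟨j', c', hc', hd⟩ := hγ.flow s (mem_univ s) hs1.continuousWithinAt
    rw [nhdsWithin_univ] at hc'
    have hj : j' = j := by
      have h1 := hc'.self_of_nhds
      rw [hs2.self_of_nhds] at h1
      exact (congrArg Sigma.fst h1).symm
    subst hj
    have heq : c =ᶠ[𝓝 s] c' := by
      filter_upwards [hc', hs2] with u hu1 hu2
      rw [hu1] at hu2
      simpa using hu2.symm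
    have h2 := (hd.hasMFDerivAt univ_mem).congr_of_eventuallyEq heq
    rw [heq.self_of_nhds]
    exact h2

/-- An execution never takes values in the guard: these are only its left limits. -/
theorem IsExecution.notMem_guard (hout : H.OutwardPointing) (hγ : H.IsExecution γ univ)
    (hiso : IsolatedTransitions γ) {a : ℝ} {j : J} {p : D j} (ha : γ a = ⟨j, p⟩) : p ∉ H.G j := by
  obtain ⟨c, rfl, -, hc⟩ := hγ.exists_isForwardCurve hiso ha
  exact hout.notMem_guard hc

variable [∀ j, T2Space (D j)]

/-- A left limit determines the next value. If `γ` is continuous at `b`, the limit is its value,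
which is never in the guard; otherwise the limit is the guard point of the jump, by uniqueness of
limits. -/
theorem IsExecution.eq_of_tendsto (hout : H.OutwardPointing) (hγ : H.IsExecution γ univ)
    (hiso : IsolatedTransitions γ) {b : ℝ} {j : J} {e : D j}
    (hb : Tendsto γ (𝓝[<] b) (𝓝 ⟨j, e⟩)) :
    (e ∈ H.G j → γ b = H.R j e) ∧ (e ∉ H.G j → γ b = ⟨j, e⟩) := by
  by_cases hcont : ContinuousWithinAt γ univ b
  · have h1 : γ b = ⟨j, e⟩ :=
      tendsto_nhds_unique (hcont.tendsto.mono_left (nhdsWithin_mono _ (subset_univ _))) hb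
    exact ⟨fun he => absurd he (hγ.notMem_guard hout hiso h1), fun _ => h1⟩
  · obtain ⟨j', g, hg, hlim, hR⟩ := hγ.jump b (mem_univ b) hcont
    rw [univ_inter] at hlim
    have h1 := tendsto_nhds_unique hlim hb
    cases h1
    exact ⟨fun _ => hR.symm, fun h => absurd hg h⟩

/-- An execution follows an integral curve through one of its points. -/
theorem IsExecution.follows (hout : H.OutwardPointing) (hγ : H.IsExecution γ univ)
    (hiso : IsolatedTransitions γ) {a b : ℝ} {j : J} {c : ℝ → D j}
    (hc : IsMIntegralCurveOn c (H.F j) (Icc a b)) (hab : a < b) (ha : γ a = ⟨j, c a⟩) :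
    (∀ s ∈ Ico a b, γ s = ⟨j, c s⟩) ∧ Tendsto γ (𝓝[<] b) (𝓝 ⟨j, c b⟩) := by
  have hlim : ∀ s ∈ Ioc a b, (∀ u ∈ Ico a s, γ u = ⟨j, c u⟩) →
      Tendsto γ (𝓝[<] s) (𝓝 ⟨j, c s⟩) := by
    intro s hs h
    have h1 : Tendsto c (𝓝[<] s) (𝓝 (c s)) :=
      (hc.continuousOn s ⟨hs.1.le, hs.2⟩).tendsto.mono_left (nhdsWithin_le_iff.2
        (mem_of_superset (Ico_mem_nhdsLT hs.1) fun u hu => ⟨hu.1, hu.2.le.trans hs.2⟩))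
    refine ((continuous_sigmaMk.tendsto (c s)).comp h1).congr' ?_
    filter_upwards [Ico_mem_nhdsLT hs.1] with u hu using (h u hu).symm
  -- Continuous induction on `[a, b]`. Agreement is required only at times before `s`, which makes
  -- the set closed without any continuity of `γ`.
  set S : Set ℝ := {s | ∀ u ∈ Ico a s, γ u = ⟨j, c u⟩} with hS
  have hclosed : IsClosed S := by
    have : S = ⋂ u ∈ {u | a ≤ u ∧ γ u ≠ ⟨j, c u⟩}, Iic u := by
      ext s
      simp only [hS, mem_ofPred_eq, mem_iInter, mem_Iic, mem_Ico]
      constructor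
      · intro h u hu
        by_contra hcon
        exact hu.2 (h u ⟨hu.1, not_le.1 hcon⟩)
      · intro h u hu
        by_contra hcon
        exact absurd (h u ⟨hu.1, hcon⟩) (not_le.2 hu.2)
    rw [this]
    exact isClosed_biInter fun _ _ => isClosed_Iic
  have hsub : Icc a b ⊆ S := by
    refine (hclosed.inter isClosed_Icc).Icc_subset_of_forall_mem_nhdsWithin
      (fun u hu => absurd hu.1 (not_le.2 hu.2)) ?_
    rintro s ⟨hsS, hs⟩
    have hfc := hc.isForwardCurve hs
    -- The curve `c` continues beyond `s`, so `c s` is not in the guard and `γ` cannot jump there.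
    have hs1 : γ s = ⟨j, c s⟩ := by
      rcases hs.1.eq_or_lt with rfl | has
      · exact ha
      · exact (hγ.eq_of_tendsto hout hiso (hlim s ⟨has, hs.2.le⟩ hsS)).2 (hout.notMem_guard hfc)
    obtain ⟨c', hc's, hev, hc'⟩ := hγ.exists_isForwardCurve hiso hs1
    have h1 := hc'.eventuallyEq (H.contMDiff_F j) hfc hc's
    obtain ⟨d, hd, hsub⟩ := mem_nhdsGE_iff_exists_Ico_subset.1 (h1.and hev)
    filter_upwards [Ioo_mem_nhdsGT hd] with r hr u hu
    rcases lt_or_ge u s with hus | hus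
    · exact hsS u ⟨hu.1, hus⟩
    · have h2 := hsub ⟨hus, hu.2.trans hr.2⟩
      rw [h2.2, h2.1]
  have hb := hsub ⟨hab.le, le_rfl⟩
  exact ⟨hb, hlim b ⟨hab, le_rfl⟩ hb⟩

theorem IsExecution.follows_shift (hout : H.OutwardPointing) (hγ : H.IsExecution γ univ)
    (hiso : IsolatedTransitions γ) {a b t₀ : ℝ} {j : J} {c : ℝ → D j}
    (hc : IsMIntegralCurveOn c (H.F j) (Icc a b)) (hab : a < b) (ha : γ (t₀ + a) = ⟨j, c a⟩) :
    (∀ s ∈ Ico a b, γ (t₀ + s) = ⟨j, c s⟩) ∧ Tendsto γ (𝓝[<] (t₀ + b)) (𝓝 ⟨j, c b⟩) := by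
  have h := hc.comp_add_Icc (d := -t₀)
  rw [sub_neg_eq_add, sub_neg_eq_add, add_comm a, add_comm b] at h
  obtain ⟨h1, h2⟩ := hγ.follows hout hiso h (by linarith) (by simpa using ha)
  refine ⟨fun s hs => ?_, by simpa using h2⟩
  simpa using h1 (t₀ + s) ⟨by linarith [hs.1], by linarith [hs.2]⟩

/-- An execution follows an arc through one of its points. -/
theorem IsExecution.follows_arc (hout : H.OutwardPointing) (hγ : H.IsExecution γ univ)
    (hiso : IsolatedTransitions γ) {N : ℕ} {j : ℕ → J} {t : ℕ → ℝ} {c : ∀ i, ℝ → D (j i)}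
    (harc : H.IsArc N j t c) {i₀ : ℕ} {t₀ : ℝ} (hlt : ∀ i, i₀ ≤ i → i < N → t i < t (i + 1))
    (hstart : γ (t₀ + t i₀) = ⟨j i₀, c i₀ (t i₀)⟩) :
    ∀ i, i₀ ≤ i → i ≤ N → γ (t₀ + t i) = ⟨j i, c i (t i)⟩ := by
  intro i hi
  induction i, hi using Nat.le_induction with
  | base => exact fun _ => hstart
  | succ i hi ih =>
    intro hiN
    have h1 := (hγ.follows_shift hout hiso (harc.flow i (by omega)) (hlt i hi hiN)
      (ih (by omega))).2
    rw [(hγ.eq_of_tendsto hout hiso h1).1 (harc.exit_mem i hiN), harc.reset i hiN]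

theorem exists_mem_Ico_succ {t : ℕ → ℝ} {s : ℝ} {i₀ : ℕ} (h0 : t i₀ ≤ s) :
    ∀ n, i₀ ≤ n → s < t (n + 1) → ∃ i, i₀ ≤ i ∧ i ≤ n ∧ s ∈ Ico (t i) (t (i + 1)) := by
  intro n hn
  induction n, hn using Nat.le_induction with
  | base => exact fun hs => ⟨i₀, le_rfl, le_rfl, h0, hs⟩
  | succ n hn ih =>
    intro hs
    rcases lt_or_ge s (t (n + 1)) with h | h
    · obtain ⟨i, hi, hin, his⟩ := ih h
      exact ⟨i, hi, by omega, his⟩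
    · exact ⟨n + 1, by omega, le_rfl, h, hs⟩

/-- If an arc starts at a point of a periodic orbit, and its end point, when it lies on the orbit,
coincides with the initial one, then it closes up and visits all domains that the orbit visits. -/
theorem IsPeriodicOrbit.arc_visits (hout : H.OutwardPointing) {τ : ℝ}
    (hγ : H.IsPeriodicOrbit γ τ) (hiso : IsolatedTransitions γ) {N : ℕ} {j : ℕ → J} {t : ℕ → ℝ}
    {c : ∀ i, ℝ → D (j i)} (harc : H.IsArc N j t c)
    (hmem : (⟨j 0, c 0 0⟩ : Σ k, D k) ∈ orbitSet γ)
    (hret : (⟨j N, c N (t (N + 1))⟩ : Σ k, D k) ∈ orbitSet γ →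
      (⟨j N, c N (t (N + 1))⟩ : Σ k, D k) = ⟨j 0, c 0 0⟩) :
    (⟨j N, c N (t (N + 1))⟩ : Σ k, D k) = ⟨j 0, c 0 0⟩ ∧ ∀ s, ∃ i ≤ N, (γ s).1 = j i := by
  have hex := hγ.execution
  have ht0 := harc.t_zero
  obtain ⟨t₀, hstart⟩ : ∃ t₀, (c 0 0 ∈ H.G (j 0) ∧ γ t₀ = H.R (j 0) (c 0 0)) ∨
      (c 0 0 ∉ H.G (j 0) ∧ γ t₀ = ⟨j 0, c 0 0⟩) := by
    obtain ⟨t₀, h | h⟩ := hmem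
    · exact ⟨t₀, Or.inr ⟨hex.notMem_guard hout hiso h, h⟩⟩
    · have h1 := hex.eq_of_tendsto hout hiso h
      by_cases hG : c 0 0 ∈ H.G (j 0)
      · exact ⟨t₀, Or.inl ⟨hG, h1.1 hG⟩⟩
      · exact ⟨t₀, Or.inr ⟨hG, h1.2 hG⟩⟩
  -- If the arc starts in the guard, piece `0` has length zero and `γ t₀` is already its reset, so
  -- tracking starts at `i₀ = 1`; otherwise at `i₀ = 0`.
  obtain ⟨i₀, hi₀N, hti₀, hlt, hγi₀⟩ : ∃ i₀ ≤ N, t i₀ = 0 ∧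
      (∀ i, i₀ ≤ i → i < N → t i < t (i + 1)) ∧ γ (t₀ + t i₀) = ⟨j i₀, c i₀ (t i₀)⟩ := by
    rcases hstart with ⟨hG, h⟩ | ⟨hG, h⟩
    · have ht1 : t 1 = 0 := by
        by_contra hne
        have h1 : t 0 < t 1 := lt_of_le_of_ne (harc.t_le 0 (Nat.zero_le _)) (by
          rw [ht0]; exact Ne.symm hne)
        have h2 := (harc.flow 0 (Nat.zero_le _)).isForwardCurve ⟨le_rfl, h1⟩
        rw [ht0] at h2
        exact hout.notMem_guard h2 hG
      have hN : 0 < N := by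
        rcases Nat.eq_zero_or_pos N with rfl | hN
        · exact absurd ht1 harc.t_pos.ne'
        · exact hN
      refine ⟨1, hN, ht1, fun i hi hiN => harc.t_lt i hi hiN, ?_⟩
      have h2 := harc.reset 0 hN
      simp only [zero_add, ht1] at h2 ⊢
      rw [add_zero, h, h2]
    · refine ⟨0, Nat.zero_le _, ht0, fun i _ hiN => ?_, by rw [ht0, add_zero, h]⟩
      rcases Nat.eq_zero_or_pos i with rfl | hi
      · refine lt_of_le_of_ne (harc.t_le 0 (Nat.zero_le _)) fun heq => hG ?_
        have h2 := harc.exit_mem 0 hiN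
        rwa [← heq, ht0] at h2
      · exact harc.t_lt i hi hiN
  have hfollow := hex.follows_arc hout hiso harc hlt hγi₀
  set T := t (N + 1) with hT
  -- A last piece of zero length consists of a reset point, which is a value of `γ`; otherwise the
  -- end point is a left limit.
  have hend : Tendsto γ (𝓝[<] (t₀ + T)) (𝓝 ⟨j N, c N T⟩) ∨ γ (t₀ + T) = ⟨j N, c N T⟩ := by
    rcases (harc.t_le N le_rfl).eq_or_lt with h | h
    · right
      have h1 := hfollow N hi₀N le_rfl
      rwa [h] at h1
    · left
      exact (hex.follows_shift hout hiso (harc.flow N le_rfl) h (hfollow N hi₀N le_rfl)).2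
  have hclose : (⟨j N, c N T⟩ : Σ k, D k) = ⟨j 0, c 0 0⟩ := by
    refine hret ⟨t₀ + T, ?_⟩
    exact hend.symm
  refine ⟨hclose, fun s => ?_⟩
  have hper : γ (t₀ + T) = γ t₀ := by
    rw [hclose] at hend
    rcases hstart with ⟨hG, h⟩ | ⟨hG, h⟩ <;> rcases hend with h' | h'
    · rw [h, (hex.eq_of_tendsto hout hiso h').1 hG]
    · exact absurd hG (hex.notMem_guard hout hiso h')
    · rw [h, (hex.eq_of_tendsto hout hiso h').2 hG]
    · rw [h, h']
  -- The arc lasts at least one period, so every value of `γ` occurs at a time in `[t₀, t₀ + T)`.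
  have hτ : τ ≤ T := hγ.minimal T harc.t_pos t₀ hper
  obtain ⟨s', hs', hss'⟩ := hγ.periodic.exists_mem_Ico hγ.period_pos s t₀
  rw [hss']
  obtain ⟨i, hi, hiN, his⟩ := exists_mem_Ico_succ (t := t) (s := s' - t₀) (i₀ := i₀)
    (by rw [hti₀]; linarith [hs'.1]) N hi₀N (by rw [← hT]; linarith [hs'.2])
  have h1 := (hex.follows_shift hout hiso (harc.flow i hiN) (his.1.trans_lt his.2)
    (hfollow i hi hiN)).1 _ his
  rw [add_sub_cancel] at h1
  exact ⟨i, hiN, by rw [h1]⟩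

end HybridSystem

end Executions

/-! ### Rank of derivatives and transversality of immersions -/

section Rank

theorem finrank_range_comp_le {V W X : Type*} [AddCommGroup V] [Module ℝ V]
    [AddCommGroup W] [Module ℝ W] [FiniteDimensional ℝ W] [AddCommGroup X] [Module ℝ X]
    (g : W →ₗ[ℝ] X) (f : V →ₗ[ℝ] W) :
    Module.finrank ℝ (LinearMap.range (g ∘ₗ f)) ≤ Module.finrank ℝ (LinearMap.range f) ∧
      (FiniteDimensional ℝ X →
        Module.finrank ℝ (LinearMap.range (g ∘ₗ f)) ≤ Module.finrank ℝ (LinearMap.range g)) := by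
  constructor
  · rw [LinearMap.range_comp]
    exact Submodule.finrank_map_le _ _
  · intro _
    exact Submodule.finrank_mono (LinearMap.range_comp_le_range f g)

/-- The linear map `(u, r) ↦ L u - r • w` is injective on a finite-dimensional space, hence bounded
below by some `K⁻¹`. Strict differentiability replaces `L` by increments of `f` at a cost of half
this bound. -/
theorem HasStrictFDerivAt.exists_nhds_transverse {E F : Type*} [NormedAddCommGroup E]
    [NormedSpace ℝ E] [FiniteDimensional ℝ E] [NormedAddCommGroup F] [NormedSpace ℝ F]
    {f : E → F} {L : E →L[ℝ] F} {x : E} (hf : HasStrictFDerivAt f L x) (hinj : Injective L) {w : F}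
    (hw : ∀ u, L u ≠ w) :
    ∃ κ : ℝ, 0 < κ ∧ ∃ s ∈ 𝓝 x, ∀ z ∈ s, ∀ z' ∈ s, ∀ r : ℝ, κ * |r| ≤ ‖f z' - f z - r • w‖ := by
  let Λ : E × ℝ →ₗ[ℝ] F := L.toLinearMap.coprod (-(LinearMap.toSpanSingleton ℝ F w))
  have hΛ : ∀ u r, Λ (u, r) = L u - r • w := fun u r => by simp [Λ, sub_eq_add_neg]
  have hker : LinearMap.ker Λ = ⊥ := by
    rw [LinearMap.ker_eq_bot']
    rintro ⟨u, r⟩ h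
    rw [hΛ, sub_eq_zero] at h
    have hr : r = 0 := by
      by_contra hr
      refine hw (r⁻¹ • u) ?_
      rw [map_smul, h, smul_smul, inv_mul_cancel₀ hr, one_smul]
    rw [hr, zero_smul] at h
    have hu : u = 0 := hinj (h.trans (map_zero L).symm)
    rw [hr, hu]; rfl
  obtain ⟨K, hK, hanti⟩ := Λ.exists_antilipschitzWith hker
  have hK' : (0 : ℝ) < K := hK
  have hKi : (0 : ℝ) < (K : ℝ)⁻¹ := inv_pos.2 hK'
  obtain ⟨s, hs, happ⟩ := hf.approximates_deriv_on_nhds (c := K⁻¹ / 2) (Or.inr (by positivity))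
  refine ⟨(K : ℝ)⁻¹ / 2, by positivity, s, hs, fun z hz z' hz' r => ?_⟩
  have h1 := happ _ hz' _ hz
  push_cast at h1
  have h2 := hanti.le_mul_dist (z' - z, r) 0
  rw [map_zero, dist_zero_right, dist_zero_right, hΛ, ← inv_mul_le_iff₀ hK'] at h2
  have h3 : ‖z' - z‖ ≤ ‖(z' - z, r)‖ := norm_fst_le (z' - z, r)
  have h4 : |r| ≤ ‖(z' - z, r)‖ := norm_snd_le (z' - z, r)
  have h5 : ‖L (z' - z) - r • w‖ ≤ ‖f z' - f z - r • w‖ + ‖f z' - f z - L (z' - z)‖ := by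
    have : L (z' - z) - r • w = (f z' - f z - r • w) - (f z' - f z - L (z' - z)) := by abel
    rw [this]; exact norm_sub_le _ _
  nlinarith

variable {E : Type*} [NormedAddCommGroup E] [NormedSpace ℝ E]
  {H : Type*} [TopologicalSpace H] {I : ModelWithCorners ℝ E H}
  {M : Type*} [TopologicalSpace M] [ChartedSpace H M]
  {E' : Type*} [NormedAddCommGroup E'] [NormedSpace ℝ E']
  {H' : Type*} [TopologicalSpace H'] {I' : ModelWithCorners ℝ E' H'}
  {M' : Type*} [TopologicalSpace M'] [ChartedSpace H' M']

theorem ContMDiffAt.hasStrictFDerivAt_writtenInExtChartAt [I.Boundaryless] {f : M → M'} {x : M}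
    (hf : ContMDiffAt I I' 1 f x) :
    HasStrictFDerivAt (writtenInExtChartAt I I' x f) (mfderiv I I' f x : E →L[ℝ] E')
      (extChartAt I x x) := by
  have h1 := (contMDiffAt_iff.1 hf).2
  rw [I.range_eq_univ, contDiffWithinAt_univ] at h1
  have h2 := h1.hasStrictFDerivAt one_ne_zero
  rw [(hf.mdifferentiableAt one_ne_zero).mfderiv, I.range_eq_univ, fderivWithin_univ]
  exact h2


/-- The rank of the derivative of a `C¹` map is lower semicontinuous. -/
theorem ContMDiffAt.eventually_finrank_range_le [FiniteDimensional ℝ E] [IsManifold I 1 M]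
    [FiniteDimensional ℝ E'] [IsManifold I' 1 M'] {f : M → M'} {x₀ : M}
    (hf : ContMDiffAt I I' 1 f x₀) :
    ∀ᶠ x in 𝓝 x₀, Module.finrank ℝ (LinearMap.range (mfderiv I I' f x₀).toLinearMap) ≤
      Module.finrank ℝ (LinearMap.range (mfderiv I I' f x).toLinearMap) := by
  -- Derivatives at different points act between different tangent spaces. In fixed tangent
  -- coordinates they vary continuously, the condition that the rank be at least `r` is open, and
  -- the coordinate changes on both sides cannot raise the rank.
  have hc : ContinuousAt (inTangentCoordinates I I' id f (mfderiv I I' f) x₀) x₀ :=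
    (hf.mfderiv_const (m := 0) (by simp)).continuousAt
  set T : M → E →L[ℝ] E' := inTangentCoordinates I I' id f (mfderiv I I' f) x₀
  have h0 : T x₀ = mfderiv I I' f x₀ := by
    refine (inTangentCoordinates_eq (I := I) (I' := I') id f (mfderiv I I' f)
      (mem_chart_source H x₀) (mem_chart_source H' (f x₀))).trans ?_
    ext u
    change tangentCoordChange I' (f x₀) (f x₀) (f x₀)
      (mfderiv I I' f x₀ (tangentCoordChange I x₀ x₀ x₀ u)) = mfderiv I I' f x₀ u
    rw [tangentCoordChange_self (mem_extChartAt_source x₀)]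
    exact tangentCoordChange_self (mem_extChartAt_source (f x₀))
  have hfin : ∀ y : M', FiniteDimensional ℝ (TangentSpace I' y) :=
    fun _ => inferInstanceAs (FiniteDimensional ℝ E')
  set r := Module.finrank ℝ (LinearMap.range (mfderiv I I' f x₀).toLinearMap) with hr
  have hopen := isOpen_setOfPred_nat_le_rank (𝕜 := ℝ) (E := E) (F := E') r
  have hmem : T x₀ ∈ {g : E →L[ℝ] E' | (r : Cardinal) ≤ LinearMap.rank (g : E →ₗ[ℝ] E')} := by
    rw [mem_ofPred_eq, h0, LinearMap.rank, hr]
    exact (Module.finrank_eq_rank ℝ _).le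
  filter_upwards [hc (hopen.mem_nhds hmem), chart_source_mem_nhds H x₀,
    hf.continuousAt (chart_source_mem_nhds H' (f x₀))] with x hx hx1 hx2
  have h1 : (r : Cardinal) ≤ LinearMap.rank (T x : E →ₗ[ℝ] E') := hx
  rw [LinearMap.rank, ← Module.finrank_eq_rank, Nat.cast_le] at h1
  refine h1.trans ?_
  have h2 := inTangentCoordinates_eq (I := I) (I' := I') id f (mfderiv I I' f) hx1 hx2
  change Module.finrank ℝ (LinearMap.range (inTangentCoordinates I I' id f
    (mfderiv I I' f) x₀ x).toLinearMap) ≤ _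
  rw [h2]
  exact (finrank_range_comp_le _ _).1.trans ((finrank_range_comp_le _ _).2 inferInstance)

/-- The rank of a `C¹` map is bounded by the dimension of its image. -/
theorem ContMDiffAt.finrank_range_mfderiv_le_of_MDimLE [CompleteSpace E]
    [FiniteDimensional ℝ E'] [I.Boundaryless] {f : M → M'} {x : M}
    (hf : ContMDiffAt I I' 1 f x) {W : Set M} (hW : W ∈ 𝓝 x) {r : ℕ}
    (h : MDimLE I' (f '' W) r) :
    Module.finrank ℝ (LinearMap.range (mfderiv I I' f x).toLinearMap) ≤ r := by
  have hW' : (extChartAt I x).symm ⁻¹' (W ∩ f ⁻¹' (extChartAt I' (f x)).source) ∈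
      𝓝 (extChartAt I x x) := by
    refine (continuousAt_extChartAt_symm x) ?_
    rw [extChartAt_to_inv]
    exact inter_mem hW (hf.continuousAt (extChartAt_source_mem_nhds (f x)))
  have h1 := hf.hasStrictFDerivAt_writtenInExtChartAt.finrank_range_le_dimH_image hW'
  have h2 : writtenInExtChartAt I I' x f '' ((extChartAt I x).symm ⁻¹'
      (W ∩ f ⁻¹' (extChartAt I' (f x)).source)) ⊆
      extChartAt I' (f x) '' (f '' W ∩ (extChartAt I' (f x)).source) := by
    rintro _ ⟨y, ⟨hyW, hys⟩, rfl⟩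
    exact ⟨_, ⟨mem_image_of_mem f hyW, hys⟩, rfl⟩
  have h3 := h1.trans ((dimH_mono h2).trans (h (f x)))
  exact_mod_cast h3

/-- An immersed hypersurface, in a chart, is uniformly transverse to a vector that is not tangent
to it. -/
theorem ContMDiffAt.exists_nhds_transverse [FiniteDimensional ℝ E] [I.Boundaryless] {f : M → M'} {x : M}
    (hf : ContMDiffAt I I' 1 f x) (hinj : Injective (mfderiv I I' f x)) {w : E'}
    (hw : ∀ u : E, (mfderiv I I' f x : E →L[ℝ] E') u ≠ w) :
    ∃ κ : ℝ, 0 < κ ∧ ∃ W ∈ 𝓝 x, ∀ z ∈ W, ∀ z' ∈ W, ∀ r : ℝ, κ * |r| ≤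
      ‖extChartAt I' (f x) (f z') - extChartAt I' (f x) (f z) - r • w‖ := by
  obtain ⟨κ, hκ, s, hs, h⟩ :=
    hf.hasStrictFDerivAt_writtenInExtChartAt.exists_nhds_transverse hinj hw
  refine ⟨κ, hκ, (extChartAt I x) ⁻¹' s ∩ (extChartAt I x).source,
    inter_mem ((continuousAt_extChartAt x) hs) (extChartAt_source_mem_nhds x), ?_⟩
  rintro z ⟨hz, hzs⟩ z' ⟨hz', hzs'⟩ r
  have h1 := h _ hz _ hz' r
  simp only [writtenInExtChartAt, comp_apply] at h1
  rwa [(extChartAt I x).left_inv hzs, (extChartAt I x).left_inv hzs'] at h1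

end Rank

/-! ### Poincaré maps and their iterates -/

section PoincareMaps

universe u v w

variable {J : Type v} {dim : J → ℕ} [∀ j, NeZero (dim j)] {D : J → Type u}
  [∀ j, TopologicalSpace (D j)] [∀ j, ChartedSpace (EuclideanHalfSpace (dim j)) (D j)]

/-- Used for the last domain of an arc, which is only propositionally equal to `D j₀`. -/
theorem MDimLE.sigma_transport {k k' : J} (h : k = k') {A : Set (D k)} {δ : ENNReal}
    (hA : MDimLE (𝓡∂ (dim k)) A δ) :
    MDimLE (𝓡∂ (dim k')) {p : D k' | ∃ a ∈ A, (⟨k, a⟩ : Σ j, D j) = ⟨k', p⟩} δ := by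
  subst h
  refine hA.mono ?_
  rintro p ⟨a, ha, hap⟩
  cases hap
  exact ha

variable [∀ j, IsManifold (𝓡∂ (dim j)) ∞ (D j)]

namespace HybridSystem

variable {H : HybridSystem dim D} {γ : ℝ → Σ j, D j}

theorem exists_sigma_transport_curve {k k' : J} (h : k = k') {c : ℝ → D k} {s : Set ℝ}
    (hc : IsMIntegralCurveOn c (H.F k) s) :
    ∃ c' : ℝ → D k', IsMIntegralCurveOn c' (H.F k') s ∧ ∀ t, (⟨k, c t⟩ : Σ j, D j) = ⟨k', c' t⟩ := by
  subst h
  exact ⟨c, hc, fun _ => rfl⟩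

variable {d : ℕ} {S : Type w} [TopologicalSpace S] [ChartedSpace (EuclideanSpace ℝ (Fin d)) S]
  {j₀ : J} {ι : S → D j₀} {ξ : S} {U : Set S} {P : S → S}

theorem rankAt_le (Q : S → S) (x : S) : rankAt d Q x ≤ d := by
  have h : FiniteDimensional ℝ (TangentSpace (𝓡 d) x) :=
    inferInstanceAs (FiniteDimensional ℝ (EuclideanSpace ℝ (Fin d)))
  have h1 : Module.finrank ℝ (TangentSpace (𝓡 d) x) = d :=
    (finrank_euclideanSpace_fin : Module.finrank ℝ (EuclideanSpace ℝ (Fin d)) = d)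
  exact (LinearMap.finrank_range_le _).trans h1.le

/-- A Poincaré map fixes the base point, and its trajectories pass through all domains that the
periodic orbit visits. -/
theorem IsPoincareMap.fixed_and_visits [∀ j, T2Space (D j)] (hout : H.OutwardPointing) {τ : ℝ}
    (hγ : H.IsPeriodicOrbit γ τ) (hiso : IsolatedTransitions γ)
    (hP : H.IsPoincareMap (d := d) γ ι ξ U P) {N : ℕ} {j : ℕ → J}
    (hret : H.FirstReturn ι N j ξ (P ξ)) :
    P ξ = ξ ∧ ∀ s, ∃ i ≤ N, (γ s).1 = j i := by
  obtain ⟨t, c, harc, h0, hN, -⟩ := hret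
  have hmem : (⟨j₀, ι ξ⟩ : Σ k, D k) ∈ orbitSet γ := (hP.sect.meets ξ).2 rfl
  obtain ⟨h1, h2⟩ := hγ.arc_visits hout hiso harc (by rwa [h0]) (fun h => by
    rw [hN] at h
    rw [hN, h0, (hP.sect.meets _).1 h])
  refine ⟨(hP.sect.meets _).1 ?_, h2⟩
  rwa [← hN, h1, h0]

/-- If all trajectories of a Poincaré map leave an `m`-dimensional domain, then its rank is at most
`m - 1` near the base point. -/
theorem IsPoincareMap.eventually_rankAt_le [IsManifold (𝓡 d) ∞ S]
    [∀ j, SecondCountableTopology (D j)] (hout : H.OutwardPointing)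
    (hP : H.IsPoincareMap (d := d) γ ι ξ U P) (hfix : P ξ = ξ) {N : ℕ} {j : ℕ → J}
    (hret : ∀ x ∈ U, H.FirstReturn ι N j x (P x)) {i m : ℕ} (hi : i < N) (hm : dim (j i) = m) :
    ∀ᶠ x in 𝓝 ξ, rankAt d P x ≤ m - 1 := by
  obtain ⟨n, rfl⟩ : ∃ n, N = n + 1 := ⟨N - 1, by omega⟩
  have hj : j (n + 1) = j₀ := by
    obtain ⟨t, c, -, -, h, -⟩ := hret ξ hP.mem
    exact congrArg Sigma.fst h
  have hι : ContMDiff (𝓡 d) (𝓡∂ (dim j₀)) 1 ι := hP.sect.hypersurface.smooth.of_le (by norm_cast)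
  set w : EuclideanSpace ℝ (Fin (dim j₀)) :=
    chartField (H.F j₀) (ι ξ) (extChartAt (𝓡∂ (dim j₀)) (ι ξ) (ι ξ)) with hw
  obtain ⟨κ, hκ, W, hW, htrans⟩ := (hι ξ).exists_nhds_transverse
    (hP.sect.hypersurface.immersion ξ) (w := w) (fun u hu => hP.sect.transverse ⟨u, by
      rw [hw, chartField_self] at hu; exact hu⟩)
  -- The last piece of the trajectory enters along a set of dimension at most `m - 1` and then hits
  -- the section, which is uniformly transverse to the flow near `ξ`.
  obtain ⟨O, hO, hhit⟩ := exists_nhds_MDimLE_hit (H.contMDiff_F j₀) (e₀ := ι ξ) (S := ι '' W) hκ (by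
    rintro _ ⟨z, hz, rfl⟩ _ ⟨z', hz', rfl⟩ r
    exact htrans z hz z' hz' r)
  have hentry := (hout.MDimLE_arc_entry hm n (by omega) (Nat.lt_succ_self n)).sigma_transport hj
  have hdim := hhit _ _ hentry
  have hPξ : ContMDiffAt (𝓡 d) (𝓡 d) ∞ P ξ := hP.smooth.contMDiffAt (hP.isOpen.mem_nhds hP.mem)
  -- The hitting estimate holds only near `ι ξ`; the fixed point property ensures that returns from
  -- points near `ξ` occur there.
  have hnhds : U ∩ P ⁻¹' (W ∩ ι ⁻¹' O) ∈ 𝓝 ξ := by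
    refine inter_mem (hP.isOpen.mem_nhds hP.mem) (hPξ.continuousAt ?_)
    rw [hfix]
    exact inter_mem hW (hι.continuous.continuousAt hO)
  have himage : MDimLE (𝓡∂ (dim j₀)) ((ι ∘ P) '' (U ∩ P ⁻¹' (W ∩ ι ⁻¹' O)))
      ((m - 1 : ℕ) : ENNReal) := by
    refine hdim.mono ?_
    rintro _ ⟨x, ⟨hxU, hxW, hxO⟩, rfl⟩
    refine ⟨⟨mem_image_of_mem ι hxW, hxO⟩, ?_⟩
    obtain ⟨t, c, harc, -, hN, -⟩ := hret x hxU
    have hflow := (harc.flow (n + 1) le_rfl).comp_add_Icc (d := t (n + 1))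
    rw [sub_self] at hflow
    obtain ⟨c', hc', heq⟩ := exists_sigma_transport_curve hj hflow
    refine ⟨c', t (n + 1 + 1) - t (n + 1), by linarith [harc.t_le (n + 1) le_rfl], hc',
      ⟨_, ⟨t, c, harc, rfl⟩, ?_⟩, ?_⟩
    · have h := heq 0
      rwa [zero_add] at h
    · have h := heq (t (n + 1 + 1) - t (n + 1))
      rw [sub_add_cancel, hN] at h
      simpa using h.symm
  filter_upwards [eventually_mem_nhds_iff.2 hnhds] with x hx
  have hxU : x ∈ U := (mem_of_mem_nhds hx).1
  have hPx : ContMDiffAt (𝓡 d) (𝓡 d) 1 P x :=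
    (hP.smooth.contMDiffAt (hP.isOpen.mem_nhds hxU)).of_le (by norm_cast)
  have hcomp : ContMDiffAt (𝓡 d) (𝓡∂ (dim j₀)) 1 (ι ∘ P) x := (hι (P x)).comp x hPx
  have h1 := hcomp.finrank_range_mfderiv_le_of_MDimLE hx himage
  rw [mfderiv_comp x ((hι (P x)).mdifferentiableAt one_ne_zero)
    (hPx.mdifferentiableAt one_ne_zero)] at h1
  refine le_trans (le_of_eq ?_) h1
  change _ = Module.finrank ℝ (LinearMap.range
    ((mfderiv (𝓡 d) (𝓡∂ (dim j₀)) ι (P x)).toLinearMap ∘ₗ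
      (mfderiv (𝓡 d) (𝓡 d) P x).toLinearMap))
  -- Since `ι` is an immersion, `ι ∘ P` and `P` have the same rank.
  rw [LinearMap.range_comp]
  exact (Submodule.equivMapOfInjective _ (hP.sect.hypersurface.immersion (P x)) _).finrank_eq

theorem IsPoincareMap.contMDiffAt_iterate (hP : H.IsPoincareMap (d := d) γ ι ξ U P) (k : ℕ) :
    ∀ x, IterateDefinedAt U P k x → ContMDiffAt (𝓡 d) (𝓡 d) ∞ P^[k] x := by
  induction k with
  | zero => exact fun x _ => contMDiffAt_id
  | succ k ih =>
    intro x hx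
    rw [iterate_succ']
    exact (hP.smooth.contMDiffAt (hP.isOpen.mem_nhds (hx k (Nat.lt_succ_self k)))).comp x
      (ih x fun i hi => hx i (by omega))

theorem IsPoincareMap.eventually_iterateDefinedAt (hP : H.IsPoincareMap (d := d) γ ι ξ U P)
    (hfix : P ξ = ξ) (k : ℕ) : ∀ᶠ x in 𝓝 ξ, IterateDefinedAt U P k x := by
  have hiter : ∀ i, P^[i] ξ = ξ := fun i => iterate_fixed hfix i
  have hdef : ∀ i, IterateDefinedAt U P i ξ := fun i l _ => by rw [hiter]; exact hP.mem
  refine (eventually_all_finite (Set.finite_Iio k)).2 fun i _ => ?_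
  refine (hP.contMDiffAt_iterate i ξ (hdef i)).continuousAt ?_
  rw [hiter]
  exact hP.isOpen.mem_nhds hP.mem

/-- Chain rule for `P^[k + 1] = P^[k] ∘ P`: the first factor applied already bounds the rank. -/
theorem IsPoincareMap.rankAt_iterate_succ_le (hP : H.IsPoincareMap (d := d) γ ι ξ U P) {k : ℕ}
    {x : S} (hx : IterateDefinedAt U P (k + 1) x) :
    rankAt d P^[k + 1] x ≤ rankAt d P x := by
  have h1 : MDifferentiableAt (𝓡 d) (𝓡 d) P x :=
    (hP.smooth.contMDiffAt (hP.isOpen.mem_nhds (hx 0 (by omega)))).mdifferentiableAt (by simp)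
  have h2 : MDifferentiableAt (𝓡 d) (𝓡 d) P^[k] (P x) :=
    (hP.contMDiffAt_iterate k (P x) fun i hi => by
      rw [← iterate_succ_apply]; exact hx (i + 1) (by omega)).mdifferentiableAt (by simp)
  unfold rankAt
  rw [iterate_succ, mfderiv_comp x h2 h1]
  have : FiniteDimensional ℝ (TangentSpace (𝓡 d) (P x)) :=
    inferInstanceAs (FiniteDimensional ℝ (EuclideanSpace ℝ (Fin d)))
  exact (finrank_range_comp_le _ _).1

end HybridSystem

end PoincareMaps

/-! ### The corollary -/

theorem mainTheorem8 {J : Type*} [Finite J] (dim : J → ℕ) [∀ j, NeZero (dim j)] (D : J → Type*)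
    [∀ j, TopologicalSpace (D j)] [∀ j, ChartedSpace (EuclideanHalfSpace (dim j)) (D j)]
    [∀ j, IsManifold (𝓡∂ (dim j)) ∞ (D j)] [∀ j, T2Space (D j)]
    [∀ j, SecondCountableTopology (D j)] [∀ j, ConnectedSpace (D j)]
    (H : HybridSystem dim D) (hout : H.OutwardPointing)
    (γ : ℝ → Σ j, D j) (τ : ℝ) (hγ : H.IsPeriodicOrbit γ τ)
    (hiso : HybridSystem.IsolatedTransitions γ)
    {d : ℕ} {S : Type*} [TopologicalSpace S] [ChartedSpace (EuclideanSpace ℝ (Fin d)) S]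
    [IsManifold (𝓡 d) ∞ S] {j₀ : J} (ι : S → D j₀) (ξ : S) (U : Set S) (P : S → S)
    (hP : H.IsPoincareMap (d := d) γ ι ξ U P)
    (m : ℕ) (hm : m = ⨅ j, dim j) (hvisit : ∃ t, dim (γ t).1 = m)
    (hrank : HybridSystem.rankAt d P^[m] ξ = m - 1) :
    (∃ V : Set S, IsOpen V ∧ ξ ∈ V ∧ V ⊆ U ∧
      ∀ x ∈ V, HybridSystem.IterateDefinedAt U P m x ∧ HybridSystem.rankAt d P^[m] x = m - 1) ∧
    H.ExactReductionHypotheses (d := d) γ τ ι ξ U P m (m - 1) := by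
  obtain ⟨N, j, hret⟩ := hP.traces
  obtain ⟨hfix, hvis⟩ := hP.fixed_and_visits hout hγ hiso (hret ξ hP.mem)
  obtain ⟨s, hs⟩ := hvisit
  -- Domains have positive dimension, so `P^[m]` contains at least one factor `P`.
  obtain ⟨k, rfl⟩ : ∃ k, m = k + 1 :=
    ⟨m - 1, by have := Nat.pos_of_ne_zero (NeZero.ne (dim (γ s).1)); omega⟩
  obtain ⟨i, hiN, hi⟩ := hvis s
  rw [hi] at hs
  have hupper : ∀ᶠ x in 𝓝 ξ, HybridSystem.rankAt d P x ≤ k + 1 - 1 := by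
    -- Either the trajectories leave the `m`-dimensional domain, or it is the domain of the section,
    -- in which case `d = m - 1` bounds every rank.
    rcases hiN.lt_or_eq with hlt | rfl
    · exact hP.eventually_rankAt_le hout hfix hret hlt hs
    · have hj : j i = j₀ := by
        obtain ⟨t, c, -, -, h, -⟩ := hret ξ hP.mem
        exact congrArg Sigma.fst h
      have hd := hP.sect.hypersurface.codim_one
      rw [← hj, hs] at hd
      exact Eventually.of_forall fun x =>
        (HybridSystem.rankAt_le P x).trans (by omega)
  have hdef := hP.eventually_iterateDefinedAt hfix (k + 1)
  have hlower := ((hP.contMDiffAt_iterate (k + 1) ξ hdef.self_of_nhds).of_le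
    (m := 1) (by norm_cast)).eventually_finrank_range_le
  have hev : ∀ᶠ x in 𝓝 ξ, x ∈ U ∧ HybridSystem.IterateDefinedAt U P (k + 1) x ∧
      HybridSystem.rankAt d P^[k + 1] x = k + 1 - 1 := by
    filter_upwards [hP.isOpen.mem_nhds hP.mem, hdef, hupper, hlower] with x hxU hx hx1 hx2
    refine ⟨hxU, hx, le_antisymm ((hP.rankAt_iterate_succ_le hx).trans hx1) ?_⟩
    rw [← hrank]
    exact hx2
  obtain ⟨V, hV, hVo, hξV⟩ := mem_nhds_iff.1 hev
  -- Local connectedness makes the component of `ξ` in `V` open, which supplies the connected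
  -- neighbourhood.
  have : LocallyConnectedSpace S :=
    ChartedSpace.locallyConnectedSpace (EuclideanSpace ℝ (Fin d)) S
  have hsub := connectedComponentIn_subset V ξ
  exact ⟨⟨V, hVo, hξV, fun x hx => (hV hx).1, fun x hx => (hV hx).2⟩,
    hγ, hiso, hP, hm, connectedComponentIn V ξ, hVo.connectedComponentIn,
    isConnected_connectedComponentIn_iff.2 hξV, mem_connectedComponentIn hξV,
    fun x hx => (hV (hsub hx)).1, fun x hx => (hV (hsub hx)).2⟩
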